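/- Let $\Sigma$ be a closed connected oriented surface and let $\Delta$ be a brane tiling of $\Sigma$: a finite bipartite graph (multiple edges allowed, no isolated vertices), with its vertices coloured black and white so that every edge joins a black vertex to a white one, which is (locally flatly) embedded in $\Sigma$ so that every connected component of its complement (every tile) is simply connected, the number of tiles being finite. Let $Q=Q_\Delta$ be the dual quiver: its vertices are the tiles, and it has one arrow for each edge of $\Delta$, crossing that edge clockwise around its black end. The arrows dual to the edges at a vertex $v$ of $\Delta$ form a cyclic path $c_v$ (clockwise for $v$ black, counterclockwise for $v$ white), and $W=W_\Delta=\sum_{v\ \mathrm{white}}c_v-\sum_{v\ \mathrm{black}}c_v$. For an arrow $a$ and a cyclic path $u$ put $\partial u/\partial a=\sum_{u=xay}yx$, where $x,y$ are paths, and extend linearly. Let $E\subset Q_1$ be a cut, i.e. a set of arrows such that, when arrows in $E$ have degree $1$ and the other arrows have degree $0$, $W$ is homogeneous of degree $1$, every term $c_v$ having degree $1$. Let $\widetilde{\mathbb{C}Q}$ be the path algebra of $Q$ localized at all arrows not in $E$: for each $a\in Q_1\setminus E$ one adjoins an arrow $a^*$ opposite to $a$ and imposes $a^*a=e_{s(a)}$,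 $aa^*=e_{t(a)}$. Let $$\mathrm{Jac}_{2d}(\widetilde{\mathbb{C}Q},W,E)=\widetilde{\mathbb{C}Q}\,/\,\langle a,\ \partial W/\partial a \mid a\in E\rangle .$$ If $r$ is the number of vertices of $Q$, then there is an isomorphism of $\mathbb{C}$-algebras $$\mathrm{Jac}_{2d}(\widetilde{\mathbb{C}Q},W,E)\cong\mathrm{Mat}_{r\times r}\big(\mathbb{C}[\pi_1(\Sigma)]\big).$$ -/

import Mathlib

namespace Tiling

/-! ### Quivers, path algebras, potentials and the 2-dimensional Jacobi algebra -/

/-- A finite quiver: vertices `Vert`, arrows `Arr`, source and target maps. -/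
structure FinQuiver where
  Vert : Type*
  Arr : Type*
  [fintypeVert : Fintype Vert]
  [fintypeArr : Fintype Arr]
  s : Arr → Vert
  t : Arr → Vert

attribute [instance] FinQuiver.fintypeVert FinQuiver.fintypeArr

namespace FinQuiver

/-- The defining relations of the path algebra on the trivial paths `e_i` and the arrows.
Products are read from right to left, so that `a = e_{t(a)} a e_{s(a)}`; products of
non-composable arrows therefore vanish. -/
inductive PathRel (Q : FinQuiver) :
    FreeAlgebra ℂ (Q.Vert ⊕ Q.Arr) → FreeAlgebra ℂ (Q.Vert ⊕ Q.Arr) → Prop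
  | idem (i : Q.Vert) : PathRel Q
      (FreeAlgebra.ι ℂ (Sum.inl i) * FreeAlgebra.ι ℂ (Sum.inl i)) (FreeAlgebra.ι ℂ (Sum.inl i))
  | orth (i j : Q.Vert) (h : i ≠ j) : PathRel Q
      (FreeAlgebra.ι ℂ (Sum.inl i) * FreeAlgebra.ι ℂ (Sum.inl j)) 0
  | one : PathRel Q (∑ i : Q.Vert, FreeAlgebra.ι ℂ (Sum.inl i)) 1
  | source (a : Q.Arr) : PathRel Q
      (FreeAlgebra.ι ℂ (Sum.inr a) * FreeAlgebra.ι ℂ (Sum.inl (Q.s a)))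
      (FreeAlgebra.ι ℂ (Sum.inr a))
  | target (a : Q.Arr) : PathRel Q
      (FreeAlgebra.ι ℂ (Sum.inl (Q.t a)) * FreeAlgebra.ι ℂ (Sum.inr a))
      (FreeAlgebra.ι ℂ (Sum.inr a))

/-- The path algebra `ℂQ`. -/
abbrev PathAlgebra (Q : FinQuiver) := RingQuot (PathRel Q)

/-- The trivial path `e_i` in `ℂQ`. -/
noncomputable def triv (Q : FinQuiver) (i : Q.Vert) : Q.PathAlgebra :=
  RingQuot.mkAlgHom ℂ (PathRel Q) (FreeAlgebra.ι ℂ (Sum.inl i))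

/-- The arrow `a` in `ℂQ`. -/
noncomputable def arr (Q : FinQuiver) (a : Q.Arr) : Q.PathAlgebra :=
  RingQuot.mkAlgHom ℂ (PathRel Q) (FreeAlgebra.ι ℂ (Sum.inr a))

open Classical in
/-- The quiver obtained from `Q` by adding an arrow `a*` (the summand `Sum.inr a`), in the
direction opposite to `a`, for every arrow `a` of the subquiver `Q'`. -/
noncomputable def double (Q : FinQuiver) (Q' : Set Q.Arr) : FinQuiver where
  Vert := Q.Vert
  Arr := Q.Arr ⊕ Q'
  s := Sum.elim Q.s (fun a => Q.t a)
  t := Sum.elim Q.t (fun a => Q.s a)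

/-- The relations `a* a = e_{s(a)}` and `a a* = e_{t(a)}` for the arrows `a` of `Q'`. -/
inductive LocRel (Q : FinQuiver) (Q' : Set Q.Arr) :
    (Q.double Q').PathAlgebra → (Q.double Q').PathAlgebra → Prop
  | left (a : Q') : LocRel Q Q'
      ((Q.double Q').arr (Sum.inr a) * (Q.double Q').arr (Sum.inl a.1))
      ((Q.double Q').triv (Q.s a))
  | right (a : Q') : LocRel Q Q'
      ((Q.double Q').arr (Sum.inl a.1) * (Q.double Q').arr (Sum.inr a))
      ((Q.double Q').triv (Q.t a))

/-- The path algebra of `Q` localized at the arrows of `Q'`. -/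
abbrev Localized (Q : FinQuiver) (Q' : Set Q.Arr) := RingQuot (LocRel Q Q')

/-- The trivial path `e_i` in the localized path algebra. -/
noncomputable def locTriv (Q : FinQuiver) (Q' : Set Q.Arr) (i : Q.Vert) : Q.Localized Q' :=
  RingQuot.mkAlgHom ℂ (LocRel Q Q') ((Q.double Q').triv i)

/-- The arrow `a` of `Q` in the localized path algebra. -/
noncomputable def locArr (Q : FinQuiver) (Q' : Set Q.Arr) (a : Q.Arr) : Q.Localized Q' :=
  RingQuot.mkAlgHom ℂ (LocRel Q Q') ((Q.double Q').arr (Sum.inl a))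

/-- Potentials, written as formal linear combinations of cyclic paths of `Q` up to cyclic rotation:
a multiset of terms `(c, u)` with a coefficient `c` and a cyclic path `u`.  A word `a₁ a₂ ⋯ aₙ`
stands for the product of its letters in this order, hence for the path that traverses `aₙ`
first. -/
abbrev Potential (Q : FinQuiver) := Multiset (ℂ × Cycle Q.Arr)

open Classical in
/-- The contribution to `∂u/∂a` of a rotation `l` of the cyclic path `u`: if `l = a r`, it is the
path `r` from `t(a)` to `s(a)` (equal to `e_{s(a)}` if `r` has no letters), and `0` otherwise. -/
noncomputable def dropFirst (Q : FinQuiver) (Q' : Set Q.Arr) (a : Q.Arr) :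
    List Q.Arr → Q.Localized Q'
  | [] => 0
  | b :: r => if b = a then Q.locTriv Q' (Q.s a) * (r.map (Q.locArr Q')).prod else 0

/-- The cyclic derivative `∂W/∂a`: the linear extension of `∂u/∂a = ∑_{u = v a w} w v`.
(`Cycle.lists u` is the multiset of the `n` rotations of a cyclic word `u` with `n` letters.) -/
noncomputable def deriv (Q : FinQuiver) (Q' : Set Q.Arr) (W : Q.Potential) (a : Q.Arr) :
    Q.Localized Q' :=
  (W.map fun p => p.1 • (p.2.lists.map (Q.dropFirst Q' a)).sum).sum

open Classical in
/-- `E` is a cut of `(Q, W)`: if the arrows in `E` have degree one and the others degree zero,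
then `W` is homogeneous of degree one, that is, each of its terms has degree one. -/
def IsCut (Q : FinQuiver) (W : Q.Potential) (E : Set Q.Arr) : Prop :=
  ∀ p ∈ W, p.1 ≠ 0 → (p.2.toMultiset.map fun a => if a ∈ E then 1 else 0).sum = 1

/-- The relations `a = 0` and `∂W/∂a = 0` for `a ∈ E`. -/
inductive Jac2dRel (Q : FinQuiver) (Q' : Set Q.Arr) (W : Q.Potential) (E : Set Q.Arr) :
    Q.Localized Q' → Q.Localized Q' → Prop
  | arrow (a : Q.Arr) (h : a ∈ E) : Jac2dRel Q Q' W E (Q.locArr Q' a) 0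
  | deriv (a : Q.Arr) (h : a ∈ E) : Jac2dRel Q Q' W E (Q.deriv Q' W a) 0

/-- The 2-dimensional Jacobi algebra of `(Q, W)` with cut `E`, localized at `Q'`. -/
abbrev Jac2d (Q : FinQuiver) (Q' : Set Q.Arr) (W : Q.Potential) (E : Set Q.Arr) :=
  RingQuot (Jac2dRel Q Q' W E)

end FinQuiver

/-! ### Embedded bipartite graphs and brane tilings -/

/-- The two colours of the vertices of a bipartite graph. -/
inductive Colour
  | black
  | white

/-- A finite bipartite graph (multiple edges allowed), with a colouring of its vertices, embedded
in a space `S`: every edge joins a black vertex to a white one and is realized by an arc which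
runs from the black to the white end. -/
structure EmbeddedGraph (S : Type*) [TopologicalSpace S] where
  V : Type
  E : Type
  [fintypeV : Fintype V]
  [fintypeE : Fintype E]
  colour : V → Colour
  /-- The end of an edge of the given colour. -/
  endpt : E → Colour → V
  colour_endpt : ∀ e c, colour (endpt e c) = c
  /-- The position of a vertex in `S`. -/
  pt : V → S
  /-- The arc in `S` that realizes an edge. -/
  arc : ∀ e, Path (pt (endpt e Colour.black)) (pt (endpt e Colour.white))
  pt_injective : Function.Injective pt
  arc_injective : ∀ e e' : E, ∀ t ∈ Set.Ioo (0 : unitInterval) 1, ∀ t' ∈ Set.Ioo (0 : unitInterval) 1,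
    arc e t = arc e' t' → e = e' ∧ t = t'
  arc_ne_pt : ∀ e : E, ∀ t ∈ Set.Ioo (0 : unitInterval) 1, ∀ v, arc e t ≠ pt v

namespace EmbeddedGraph

attribute [instance] EmbeddedGraph.fintypeV EmbeddedGraph.fintypeE

variable {S : Type*} [TopologicalSpace S] (G : EmbeddedGraph S)

/-- The subset of `S` covered by the vertices and edges. -/
def support : Set S := Set.range G.pt ∪ ⋃ e, Set.range (G.arc e)

/-- The arc of an edge, starting from its end of colour `c`. -/
def arcFrom (e : G.E) : Colour → unitInterval → S
  | Colour.black => fun t => G.arc e t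
  | Colour.white => fun t => G.arc e (unitInterval.symm t)

/-- The tiles: the connected components of the complement of the graph. -/
abbrev Tile := ConnectedComponents ↥(G.supportᶜ)

end EmbeddedGraph

/-- The point `exp (2 π i θ / d)` of the unit circle; for `θ = 0, …, d - 1` these are the
directions of `d` equidistant rays. -/
noncomputable def dir (d : ℕ) (θ : ℝ) : ℂ :=
  Complex.exp (2 * Real.pi * Complex.I * (θ / d))

/-- A brane tiling of the surface `S`: an embedded bipartite graph in `S` whose tiles are simply
connected.

The local structure of an embedded graph in an oriented surface is recorded by oriented charts:
the chart at a vertex `v` of degree `d` maps an open neighbourhood of the open star of `v` onto the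
open unit disc in `ℂ`, such that `v` becomes the centre and the edges at `v` become the `d` rays
in the directions `dir d k`, numbered counterclockwise.  Charts at the two ends of an edge induce
the same orientation of the surface along this edge: the left-hand side of the edge, seen from the
black end, is its right-hand side, seen from the white end. -/
structure BraneTiling (S : Type*) [TopologicalSpace S] extends EmbeddedGraph S where
  deg : V → ℕ
  deg_pos : ∀ v, 0 < deg v
  /-- The edges at `v` in counterclockwise order. -/
  edgeAt : ∀ v, Fin (deg v) ≃ {e : E // endpt e (colour v) = v}
  chart : V → OpenPartialHomeomorph S ℂ
  chart_target : ∀ v, (chart v).target = Metric.ball 0 1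
  chart_edge : ∀ v (k : Fin (deg v)) (t : unitInterval), t < 1 →
    (chart v).symm ((t : ℝ) * dir (deg v) (k : ℕ)) =
      toEmbeddedGraph.arcFrom (edgeAt v k).1 (colour v) t
  chart_support : ∀ v, ∀ z ∈ Metric.ball (0 : ℂ) 1,
    (chart v).symm z ∈ toEmbeddedGraph.support →
      ∃ (k : Fin (deg v)) (t : unitInterval), z = (t : ℝ) * dir (deg v) (k : ℕ)
  oriented : ∀ (b w : V) (k : Fin (deg b)) (l : Fin (deg w)), colour b = Colour.black →
    colour w = Colour.white → (edgeAt b k).1 = (edgeAt w l).1 →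
    ∀ t ∈ Set.Ioo (0 : unitInterval) 1, ∀ᶠ y in nhds (arc (edgeAt b k).1 t),
      (0 < (chart b y / dir (deg b) (k : ℕ)).im ↔ (chart w y / dir (deg w) (l : ℕ)).im < 0)
  finite_tile : Finite toEmbeddedGraph.Tile
  simplyConnected_tile : ∀ x : ↥(toEmbeddedGraph.supportᶜ),
    SimplyConnectedSpace (connectedComponent x)

namespace BraneTiling

variable {S : Type*} [TopologicalSpace S] (Δ : BraneTiling S)

theorem norm_dir (d : ℕ) (θ : ℝ) : ‖dir d θ‖ = 1 := by
  have h : dir d θ = Complex.exp (((2 * Real.pi * (θ / d) : ℝ) : ℂ) * Complex.I) := by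
    unfold dir
    congr 1
    push_cast
    ring
  rw [h, Complex.norm_exp_ofReal_mul_I]

/-- The point of the chart at `v` with angle midway between the rays `m` and `m + 1`
(modulo the degree) is not on the graph. -/
theorem corner_notMem (v : Δ.V) (m : ℤ) :
    (Δ.chart v).symm ((1 / 2 : ℝ) * dir (Δ.deg v) (m + 1 / 2)) ∈ Δ.toEmbeddedGraph.supportᶜ := by
  intro hmem
  have hball : ((1 / 2 : ℝ) : ℂ) * dir (Δ.deg v) (m + 1 / 2) ∈ Metric.ball (0 : ℂ) 1 := by
    rw [mem_ball_zero_iff, norm_mul, norm_dir, Complex.norm_real]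
    norm_num
  obtain ⟨k, t, h⟩ := Δ.chart_support v _ hball hmem
  have ht : (1 / 2 : ℝ) = t := by
    have h1 := congrArg norm h
    rw [norm_mul, norm_mul, norm_dir, norm_dir, Complex.norm_real, Complex.norm_real,
      Real.norm_of_nonneg t.2.1] at h1
    rw [Real.norm_of_nonneg (by norm_num)] at h1
    linarith
  rw [← ht] at h
  have h2 := mul_left_cancel₀ (by norm_num : (((1 / 2 : ℝ)) : ℂ) ≠ 0) h
  unfold dir at h2
  obtain ⟨n, hn⟩ := Complex.exp_eq_exp_iff_exists_int.mp h2
  have hd : (Δ.deg v : ℂ) ≠ 0 := by exact_mod_cast (Δ.deg_pos v).ne'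
  have hpi : (2 * Real.pi * Complex.I : ℂ) ≠ 0 := Complex.two_pi_I_ne_zero
  have h3 : (2 * Real.pi * Complex.I : ℂ) * ((m : ℂ) + 1 / 2) =
      (2 * Real.pi * Complex.I : ℂ) * ((k : ℕ) + n * Δ.deg v) := by
    push_cast at hn
    field_simp at hn
    linear_combination (Real.pi * Complex.I : ℂ) * hn
  have h4 := mul_left_cancel₀ hpi h3
  have h5 : (((2 * m + 1 : ℤ)) : ℂ) = ((2 * ((k : ℕ) + n * Δ.deg v) : ℤ) : ℂ) := by
    push_cast
    linear_combination 2 * h4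
  have h6 : (2 * m + 1 : ℤ) = 2 * ((k : ℕ) + n * Δ.deg v) := by exact_mod_cast h5
  omega

/-- The tile that contains the sector at `v` between the rays `m` and `m + 1`
(modulo the degree). -/
noncomputable def corner (v : Δ.V) (m : ℤ) : Δ.Tile :=
  ConnectedComponents.mk ⟨_, Δ.corner_notMem v m⟩

/-- The number of an edge in the counterclockwise order at its black end. -/
def pos (e : Δ.E) : Fin (Δ.deg (Δ.endpt e Colour.black)) :=
  (Δ.edgeAt _).symm ⟨e, by rw [Δ.colour_endpt]⟩

/-- The quiver dual to the tiling: its vertices are the tiles, and the arrow dual to an edge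
crosses this edge clockwise around the black end. -/
noncomputable def quiver : FinQuiver where
  Vert := Δ.Tile
  Arr := Δ.E
  fintypeVert := @Fintype.ofFinite _ Δ.finite_tile
  s e := Δ.corner (Δ.endpt e Colour.black) (Δ.pos e : ℕ)
  t e := Δ.corner (Δ.endpt e Colour.black) ((Δ.pos e : ℕ) - 1)

/-- The cyclic path `c_v` through the duals of all edges at `v`.  It runs clockwise around a black
and counterclockwise around a white vertex (in a word, the last letter is traversed first). -/
def cyc (v : Δ.V) : Cycle Δ.E :=
  match Δ.colour v with
  | Colour.black => (List.ofFn fun k => (Δ.edgeAt v k).1 : List Δ.E)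
  | Colour.white => (List.ofFn fun k => (Δ.edgeAt v k).1 : List Δ.E).reverse

/-- The potential: the sum of the `c_v` over the white `v` minus the sum over the black `v`. -/
noncomputable def potential : Δ.quiver.Potential :=
  Finset.univ.val.map fun v : Δ.V =>
    ((match Δ.colour v with
      | Colour.black => (-1 : ℂ)
      | Colour.white => 1), Δ.cyc v)

end BraneTiling

end Tiling

/-! The tiling has a dual cell structure on the surface: the tiles give the points, the arrows of
`Q` the 1-cells, and the vertices `v` the discs, attached along the cycles `c_v`. Hence the
fundamental groupoid with one base point per tile is generated by the arrows and their inverses,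
subject to `c_v = 1` for all `v`. This groupoid is connected, so its algebra is the algebra of `r ×
r` matrices over `ℂ[π₁]`.

The Jacobi algebra `J` is this groupoid algebra. Every `c_v` contains exactly one arrow `a ∈ E`;
rotate it to `a r`. All letters of `r` are outside `E`, so `r` is invertible in `J`, and `∂W/∂a = 0`
says that the two complements `r` of `a`, at its black and at its white end, agree. The arrow `a`
itself is zero in `J`, but the inverse `A a` of the common complement takes its place. With `A a =
a` for `a ∉ E`, the elements `A a` satisfy all relations `c_v = 1`, and no other relation is left.

The presentation of the groupoid enters as two separate facts. Generation
(`fundamentalGroup_induction`) cuts a path into pieces that lie in stars of vertices or avoid the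
graph. Sufficiency of the relations (`exists_monoidHom_of_prod_eq_one`) says that group-valued
labels of the edges with trivial products around the vertices come, up to a change of gauge, from a
representation of `π₁`; this is the monodromy of a covering glued from the stars and the tiles
(`exists_transport`).

Applied to `A`, the second fact yields a representation of `π₁` in `J` (`exists_representation`) and
so a homomorphism from the matrix algebra to `J` (`exists_matrix_hom`). The map back comes from the
universal property of `J` (`exists_jac2d_lift`), because the dual loops satisfy the same relations.
Both composites are the identity on generators. -/

/-! ### Path classes subordinate to an open cover, and transport along them. -/

section PathClasses

variable {X : Type*} [TopologicalSpace X]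

open Topology unitInterval in
/-- A property of path classes which is closed under concatenation and holds for the classes of
all paths inside the members of an open cover holds for all path classes. -/
theorem Path.Homotopic.Quotient.induction_of_open_cover {ι : Type*} {U : ι → Set X}
    (hU : ∀ i, IsOpen (U i)) (hcov : ∀ x, ∃ i, x ∈ U i)
    {P : ∀ {x y : X}, Path.Homotopic.Quotient x y → Prop}
    (hsmall : ∀ i {x y : X} (p : Path x y), (∀ t, p t ∈ U i) → P (.mk p))
    (htrans : ∀ {x y z : X} (γ : Path.Homotopic.Quotient x y) (γ' : Path.Homotopic.Quotient y z),
      P γ → P γ' → P (γ.trans γ'))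
    {x y : X} (γ : Path.Homotopic.Quotient x y) : P γ := by
  induction γ using Path.Homotopic.Quotient.ind with | mk p =>
  have hconn : ∀ a b c, P (.mk (p.subpath a b)) → P (.mk (p.subpath b c)) →
      P (.mk (p.subpath a c)) := by
    intro a b c h1 h2
    have := htrans _ _ h1 h2
    rwa [← Path.Homotopic.Quotient.mk_trans,
      Path.Homotopic.Quotient.eq.2 ⟨Path.Homotopy.subpathTransSubpath p a b c⟩] at this
  -- Both directions of travel are recorded: the set below is open by means of the subpaths from `t`
  -- to `s`, and closed by means of those from `s` to `t`.
  have hloc : ∀ t : I, ∀ᶠ s in 𝓝 t, P (.mk (p.subpath t s)) ∧ P (.mk (p.subpath s t)) := by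
    intro t
    obtain ⟨i, hi⟩ := hcov (p t)
    have hV : p ⁻¹' U i ∈ 𝓝 t := p.continuous.continuousAt.preimage_mem_nhds ((hU i).mem_nhds hi)
    obtain ⟨l, r, -, hVn, hVs⟩ := exists_Icc_mem_subset_of_mem_nhds hV
    filter_upwards [hVn] with s hs
    have hsub : ∀ a ∈ Set.Icc l r, ∀ b ∈ Set.Icc l r, ∀ r, p.subpath a b r ∈ U i := by
      intro a ha b hb r
      have : p.subpath a b r ∈ Set.range (p.subpath a b) := ⟨r, rfl⟩
      rw [Path.range_subpath] at this
      obtain ⟨c, hc, hcr⟩ := this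
      rw [← hcr]
      exact hVs (Set.ordConnected_Icc.uIcc_subset ha hb hc)
    have ht : t ∈ Set.Icc l r := mem_of_mem_nhds hVn
    exact ⟨hsmall i _ (hsub _ ht _ hs), hsmall i _ (hsub _ hs _ ht)⟩
  -- Connectedness of the interval takes the place of a finite subdivision.
  have hclopen : IsClopen {t : I | P (.mk (p.subpath 0 t))} := by
    refine ⟨⟨isOpen_iff_mem_nhds.2 fun t ht => ?_⟩, isOpen_iff_mem_nhds.2 fun t ht => ?_⟩
    · filter_upwards [hloc t] with s hs h
      exact ht (hconn _ _ _ h hs.2)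
    · filter_upwards [hloc t] with s hs
      exact hconn _ _ _ ht hs.1
  have h1 : (1 : I) ∈ {t : I | P (.mk (p.subpath 0 t))} := by
    rw [hclopen.eq_univ ⟨0, (hloc 0).self_of_nhds.1⟩]
    trivial
  have key : ∀ {x' y' : X} (hx : x' = x) (hy : y' = y), P (.mk (p.cast hx hy)) → P (.mk p) := by
    rintro _ _ rfl rfl h
    exact h
  have h2 : P (.mk (p.subpath 0 1)) := h1
  rw [Path.subpath_zero_one] at h2
  exact key _ _ h2

open Topology in
/-- Transport along paths for a locally constant `G`-valued cocycle which is the coboundary of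
the (not necessarily continuous) cochain `h`. -/
theorem exists_transport {ι G : Type*} [Group G] {U : ι → Set X}
    (hU : ∀ i, IsOpen (U i)) (hcov : ∀ x, ∃ i, x ∈ U i) (h : ι → X → G)
    (hloc : ∀ i j, ∀ x ∈ U i ∩ U j, ∀ᶠ y in 𝓝 x,
      (h j y)⁻¹ * h i y = (h j x)⁻¹ * h i x) :
    ∃ Ψ : ∀ {x y : X}, Path.Homotopic.Quotient x y → G,
      (∀ {x y z : X} (γ : Path.Homotopic.Quotient x y) (γ' : Path.Homotopic.Quotient y z),
        Ψ (γ.trans γ') = Ψ γ' * Ψ γ) ∧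
      ∀ i {x y : X} (p : Path x y), (∀ t, p t ∈ U i) →
        Ψ (Path.Homotopic.Quotient.mk p) = h i y * (h i x)⁻¹ := by
  let _ : TopologicalSpace G := ⊥
  have : DiscreteTopology G := ⟨rfl⟩
  choose idx hidx using hcov
  -- The cocycle glues the products `U i × G`, with `G` discrete, to a covering of `X`. Its
  -- monodromy will be `Ψ`.
  let Z : FiberBundleCore ι X G :=
    { baseSet := U
      isOpen_baseSet := hU
      indexAt := idx
      mem_baseSet_at := hidx
      coordChange := fun i j x g => (h j x)⁻¹ * h i x * g
      coordChange_self := by intros; simp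
      continuousOn_coordChange := by
        rintro i j ⟨x, g⟩ ⟨hx, -⟩
        refine ContinuousAt.continuousWithinAt ?_
        have : (fun p : X × G => (h j p.1)⁻¹ * h i p.1 * p.2) =ᶠ[𝓝 (x, g)]
            fun p => ((h j x)⁻¹ * h i x) * p.2 := by
          filter_upwards [continuousAt_fst.eventually (hloc i j x hx)] with p hp
          rw [hp]
        exact (ContinuousAt.congr (by fun_prop) this.symm)
      coordChange_comp := by intros; group }
  have cov : IsCoveringMap (Bundle.TotalSpace.proj : Z.TotalSpace → X) :=
    FiberBundle.isCoveringMap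
  -- The point over `x` which has the coordinate `(h i x)⁻¹ * g` in every chart `i` around `x`. Thus
  -- `h` trivializes the covering fibrewise, though not continuously.
  let pt : ∀ x : X, G → (Bundle.TotalSpace.proj : Z.TotalSpace → X) ⁻¹' {x} :=
    fun x g => ⟨⟨x, (h (idx x) x)⁻¹ * g⟩, rfl⟩
  have hptinj : ∀ x g g', pt x g = pt x g' → g = g' := by
    intro x g g' hg
    have h1 : (⟨x, (h (idx x) x)⁻¹ * g⟩ : Z.TotalSpace) = ⟨x, (h (idx x) x)⁻¹ * g'⟩ :=
      congrArg Subtype.val hg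
    have h2 : (h (idx x) x)⁻¹ * g = (h (idx x) x)⁻¹ * g' := 
      (Bundle.TotalSpace.mk.injEq ..  ▸ h1).2 |> eq_of_heq
    exact mul_left_cancel h2
  have hsmall : ∀ i {x y : X} (p : Path x y), (∀ t, p t ∈ U i) → ∀ g,
      cov.monodromy (.mk p) (pt x g) = pt y (h i y * (h i x)⁻¹ * g) := by
    intro i x y p hp g
    -- The lift of `p` whose coordinate in the chart `i` is constant.
    let q : unitInterval → Z.TotalSpace := fun t => (Z.localTriv i).toOpenPartialHomeomorph.symm
      (p t, (h i x)⁻¹ * g)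
    have hq : ∀ t, q t = ⟨p t, (h (idx (p t)) (p t))⁻¹ * h i (p t) * ((h i x)⁻¹ * g)⟩ :=
      fun t => Z.localTriv_symm_apply i _
    have hqc : Continuous q := by
      have hc := (Z.localTriv i).toOpenPartialHomeomorph.continuousOn_symm
      refine hc.comp_continuous (by fun_prop) fun t => ?_
      exact (Z.mem_localTriv_target i _).2 (hp t)
    let Γ : Path (pt x g).1 (pt y (h i y * (h i x)⁻¹ * g)).1 :=
      { toFun := q
        continuous_toFun := hqc
        source' := by
          rw [hq, p.source]
          simp [pt]
        target' := by
          rw [hq, p.target]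
          simp [pt, mul_assoc] }
    refine cov.monodromy_eq_of_map_eq (Path.Homotopic.Quotient.mk Γ) ?_
    refine congrArg Path.Homotopic.Quotient.mk ?_
    ext t
    change (q t).proj = p t
    rw [hq]
  have hex : ∀ {x y : X} (γ : Path.Homotopic.Quotient x y),
      ∃ u : G, ∀ g, cov.monodromy γ (pt x g) = pt y (u * g) := by
    intro x y γ
    refine Path.Homotopic.Quotient.induction_of_open_cover
      (P := fun {x y} γ => ∃ u : G, ∀ g, cov.monodromy γ (pt x g) = pt y (u * g))
      hU (fun x => ⟨idx x, hidx x⟩) (fun i x y p hp => ⟨_, hsmall i p hp⟩) ?_ γ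
    rintro x y z γ γ' ⟨u, hu⟩ ⟨u', hu'⟩
    exact ⟨u' * u, fun g => by rw [cov.monodromy_trans_apply, hu, hu', mul_assoc]⟩
  choose Ψ hΨ using @hex
  refine ⟨@Ψ, ?_, ?_⟩
  · intro x y z γ γ'
    have h1 := hΨ (γ.trans γ') 1
    rw [cov.monodromy_trans_apply, hΨ, hΨ] at h1
    simpa using (hptinj _ _ _ h1).symm
  · intro i x y p hp
    have h1 := hΨ (.mk p) 1
    rw [hsmall i p hp] at h1
    simpa using (hptinj _ _ _ h1).symm

/-- Two paths in a simply connected subset with the same ends are homotopic. -/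
theorem IsSimplyConnected.mk_eq {A : Set X} (hA : IsSimplyConnected A) {x y : X} (p q : Path x y)
    (hp : ∀ t, p t ∈ A) (hq : ∀ t, q t ∈ A) :
    Path.Homotopic.Quotient.mk p = Path.Homotopic.Quotient.mk q := by
  have : SimplyConnectedSpace A := hA
  have hx : x ∈ A := by simpa using hp 0
  have hy : y ∈ A := by simpa using hp 1
  let lift : ∀ r : Path x y, (∀ t, r t ∈ A) → Path (⟨x, hx⟩ : A) ⟨y, hy⟩ := fun r hr =>
    { toFun := fun t => ⟨r t, hr t⟩
      continuous_toFun := by fun_prop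
      source' := by simp
      target' := by simp }
  have h := (SimplyConnectedSpace.paths_homotopic (lift p hp) (lift q hq)).map
    ⟨Subtype.val, continuous_subtype_val⟩
  exact Path.Homotopic.Quotient.eq.2 h

end PathClasses

/-! ### Polar coordinates and cyclic products. -/

namespace Tiling

theorem dir_ne_zero (d : ℕ) (θ : ℝ) : dir d θ ≠ 0 := Complex.exp_ne_zero _

theorem dir_add (d : ℕ) (θ θ' : ℝ) : dir d (θ + θ') = dir d θ * dir d θ' := by
  unfold dir
  rw [← Complex.exp_add]
  congr 1
  push_cast
  ring

theorem dir_int_mul {d : ℕ} (hd : 0 < d) (n : ℤ) : dir d (n * d) = 1 := by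
  have hd' : (d : ℂ) ≠ 0 := by exact_mod_cast hd.ne'
  unfold dir
  rw [Complex.exp_eq_one_iff]
  refine ⟨n, ?_⟩
  push_cast
  field_simp

theorem dir_add_int_mul {d : ℕ} (hd : 0 < d) (θ : ℝ) (n : ℤ) : dir d (θ + n * d) = dir d θ := by
  rw [dir_add, dir_int_mul hd, mul_one]

@[fun_prop]
theorem continuous_dir (d : ℕ) : Continuous (dir d) := by
  unfold dir
  fun_prop

/-- The argument of a complex number, in units of `1/d` of the full turn. -/
noncomputable def ang (d : ℕ) (z : ℂ) : ℝ := d * z.arg / (2 * Real.pi)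

theorem eq_norm_mul_dir_ang {d : ℕ} (hd : 0 < d) (z : ℂ) : z = (‖z‖ : ℝ) * dir d (ang d z) := by
  have hd' : (d : ℂ) ≠ 0 := by exact_mod_cast hd.ne'
  have hpi : (Real.pi : ℂ) ≠ 0 := by exact_mod_cast Real.pi_ne_zero
  conv_lhs => rw [← Complex.norm_mul_exp_arg_mul_I z]
  unfold dir ang
  congr 2
  push_cast
  field_simp

theorem norm_mul_dir (d : ℕ) {ρ : ℝ} (hρ : 0 ≤ ρ) (θ : ℝ) : ‖(ρ : ℂ) * dir d θ‖ = ρ := by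
  rw [norm_mul, BraneTiling.norm_dir, Complex.norm_real, Real.norm_of_nonneg hρ, mul_one]

theorem eq_add_int_mul_of_mul_dir_eq {d : ℕ} (hd : 0 < d) {ρ ρ' θ θ' : ℝ} (hρ : 0 < ρ)
    (hρ' : 0 ≤ ρ') (h : (ρ : ℂ) * dir d θ = ρ' * dir d θ') : ∃ n : ℤ, θ = θ' + n * d := by
  have h1 : ρ = ρ' := by
    have := congrArg norm h
    rwa [norm_mul_dir d hρ.le, norm_mul_dir d hρ'] at this
  subst h1
  have h2 := mul_left_cancel₀ (by exact_mod_cast hρ.ne') h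
  unfold dir at h2
  obtain ⟨n, hn⟩ := Complex.exp_eq_exp_iff_exists_int.mp h2
  have hd' : (d : ℂ) ≠ 0 := by exact_mod_cast hd.ne'
  have h3 : (2 * Real.pi * Complex.I : ℂ) * (θ : ℂ) =
      (2 * Real.pi * Complex.I : ℂ) * (θ' + n * d) := by
    field_simp at hn
    linear_combination (2 * Real.pi * Complex.I : ℂ) * hn
  refine ⟨n, ?_⟩
  exact_mod_cast mul_left_cancel₀ Complex.two_pi_I_ne_zero h3

open Topology in
/-- Polar coordinates close to given ones. -/
theorem eventually_exists_polar {d : ℕ} (hd : 0 < d) {ρ θ ε : ℝ} (hρ : 0 < ρ) (hε : 0 < ε) :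
    ∀ᶠ z in 𝓝 ((ρ : ℂ) * dir d θ), ∃ θ', |θ' - θ| < ε ∧ z = (‖z‖ : ℝ) * dir d θ' ∧ 0 < ‖z‖ ∧
      (0 < (z / dir d θ).im ↔ θ < θ') ∧ ((z / dir d θ).im < 0 ↔ θ' < θ) := by
  have hdR : (0 : ℝ) < d := by exact_mod_cast hd
  -- Division by `dir d θ` rotates the given point to the positive real axis, where the argument is
  -- continuous.
  have hval : ((ρ : ℂ) * dir d θ) / dir d θ = ρ := mul_div_cancel_right₀ _ (dir_ne_zero d θ)
  have hslit : ((ρ : ℂ) * dir d θ) / dir d θ ∈ Complex.slitPlane := by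
    rw [hval]
    exact Or.inl (by simpa using hρ)
  have hdiv : ContinuousAt (fun z : ℂ => z / dir d θ) ((ρ : ℂ) * dir d θ) := by fun_prop
  have hre : ∀ᶠ z in 𝓝 ((ρ : ℂ) * dir d θ), 0 < (z / dir d θ).re := by
    refine (Complex.continuous_re.continuousAt.comp hdiv).eventually (lt_mem_nhds ?_)
    change 0 < ((ρ : ℂ) * dir d θ / dir d θ).re
    rw [hval]
    simpa using hρ
  have hang : ∀ᶠ z in 𝓝 ((ρ : ℂ) * dir d θ), |ang d (z / dir d θ)| < ε := by
    have hc : ContinuousAt (fun z : ℂ => |ang d (z / dir d θ)|) ((ρ : ℂ) * dir d θ) := by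
      unfold ang
      have := ContinuousAt.comp (f := fun z : ℂ => z / dir d θ) (Complex.continuousAt_arg hslit) hdiv
      exact ((continuousAt_const.mul this).div_const _).abs
    refine hc.eventually (gt_mem_nhds ?_)
    simp [hval, ang, Complex.arg_ofReal_of_nonneg hρ.le, hε]
  filter_upwards [hre, hang] with z hz1 hz2
  have hz0 : z ≠ 0 := by
    rintro rfl
    simp at hz1
  have hpos : (0 : ℝ) < d / (2 * Real.pi) := by positivity
  have hangeq : ang d (z / dir d θ) = d / (2 * Real.pi) * (z / dir d θ).arg := by
    unfold ang
    ring
  refine ⟨θ + ang d (z / dir d θ), by simpa using hz2, ?_, norm_pos_iff.2 hz0, ?_, ?_⟩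
  · rw [dir_add]
    have h1 := eq_norm_mul_dir_ang hd (z / dir d θ)
    rw [norm_div, BraneTiling.norm_dir, div_one, div_eq_iff (dir_ne_zero d θ)] at h1
    linear_combination h1
  · rw [lt_add_iff_pos_right, hangeq, mul_pos_iff_of_pos_left hpos]
    constructor
    · intro h
      refine lt_of_le_of_ne (Complex.arg_nonneg_iff.2 h.le) fun h0 => ?_
      exact h.ne' (Complex.arg_eq_zero_iff.1 h0.symm).2
    · intro h
      refine lt_of_le_of_ne (Complex.arg_nonneg_iff.1 h.le) fun h0 => ?_
      exact h.ne' (Complex.arg_eq_zero_iff.2 ⟨hz1.le, h0.symm⟩)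
  · rw [add_lt_iff_neg_left, hangeq, mul_neg_iff, ← Complex.arg_neg_iff]
    simp [hpos, hpos.not_gt]

/-- A function on `ℤ` with the period `d` such that `P m = x m * P (m - 1)`, where the index of
`x` is read modulo `d`. -/
theorem exists_periodic_potential {G : Type*} [Group G] {d : ℕ} (hd : 0 < d) (x : Fin d → G)
    (hx : (List.ofFn x).reverse.prod = 1) :
    ∃ P : ℤ → G, (∀ m n : ℤ, P (m + n * d) = P m) ∧
      ∀ k : Fin d, P (k : ℕ) = x k * P ((k : ℕ) - 1) := by
  let Q : ℕ → G := fun n => ((List.ofFn x).take n).reverse.prod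
  have hQ0 : Q 0 = 1 := by simp [Q]
  have hQd : Q d = 1 := by
    simp only [Q]
    rw [List.take_of_length_le (by simp), hx]
  have hQs : ∀ k : Fin d, Q ((k : ℕ) + 1) = x k * Q k := by
    intro k
    simp only [Q]
    rw [List.take_succ_eq_append_getElem (by simp)]
    simp
  -- With the shift by one, `P k = x k ⋯ x 0`, and `P (-1)` is the full product. As this is `1`, the
  -- recursion also holds at `k = 0`.
  refine ⟨fun m => Q ((m % d).toNat + 1), fun m n => by simp, fun k => ?_⟩
  have hk : (((k : ℕ) : ℤ) % d).toNat = k := by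
    rw [Int.emod_eq_of_lt (by omega) (by have := k.2; omega)]
    simp
  simp only [hk, hQs k]
  congr 1
  rcases Nat.eq_zero_or_pos (k : ℕ) with h0 | h0
  · have : ((((k : ℕ) : ℤ) - 1) % d).toNat = d - 1 := by
      rw [h0, show (((0 : ℕ) : ℤ) - 1) = (d - 1) + (-1) * d by push_cast; ring,
        Int.add_mul_emod_self_right, Int.emod_eq_of_lt (by omega) (by omega)]
      omega
    rw [this, h0, hQ0, Nat.sub_add_cancel hd, hQd]
  · have : ((((k : ℕ) : ℤ) - 1) % d).toNat = k - 1 := by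
      rw [Int.emod_eq_of_lt (by omega) (by have := k.2; omega)]
      omega
    rw [this, Nat.sub_add_cancel h0]

/-- The product telescopes to `P (d - 1) * (P (-1))⁻¹`. This is the converse of
`exists_periodic_potential`. -/
theorem prod_reverse_ofFn_of_potential {G : Type*} [Group G] {d : ℕ} (x : Fin d → G) (P : ℤ → G)
    (hper : P (d - 1) = P (-1)) (hP : ∀ k : Fin d, P (k : ℕ) = x k * P ((k : ℕ) - 1)) :
    (List.ofFn x).reverse.prod = 1 := by
  have key : ∀ n ≤ d, ((List.ofFn x).take n).reverse.prod = P (n - 1) * (P (-1))⁻¹ := by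
    intro n hn
    induction n with
    | zero => simp
    | succ n ih =>
      rw [List.take_succ_eq_append_getElem (by simpa using hn), List.reverse_append,
        List.prod_append, ih (by omega)]
      have := hP ⟨n, hn⟩
      simp at this
      simp [this, mul_assoc]
  have := key d le_rfl
  rw [List.take_of_length_le (by simp), hper] at this
  simpa using this

end Tiling

/-! ### Stars of vertices, their sectors and rays. -/

namespace Tiling

namespace BraneTiling

open Topology unitInterval

variable {S : Type*} [TopologicalSpace S] (Δ : BraneTiling S)

/-- The domain of the chart at `v`: an open disc around `v` which contains the open star of `v`. -/
def star (v : Δ.V) : Set S := (Δ.chart v).source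

theorem isOpen_star (v : Δ.V) : IsOpen (Δ.star v) := (Δ.chart v).open_source

theorem degPos (v : Δ.V) : 0 < Δ.deg v := Δ.deg_pos v

theorem symm_mem_star {v : Δ.V} {z : ℂ} (hz : z ∈ Metric.ball (0 : ℂ) 1) :
    (Δ.chart v).symm z ∈ Δ.star v :=
  (Δ.chart v).map_target (by rwa [Δ.chart_target])

theorem chart_symm {v : Δ.V} {z : ℂ} (hz : z ∈ Metric.ball (0 : ℂ) 1) :
    Δ.chart v ((Δ.chart v).symm z) = z :=
  (Δ.chart v).right_inv (by rwa [Δ.chart_target])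

theorem chart_mem_ball {v : Δ.V} {y : S} (hy : y ∈ Δ.star v) :
    Δ.chart v y ∈ Metric.ball (0 : ℂ) 1 := by
  rw [← Δ.chart_target v]
  exact (Δ.chart v).map_source hy

theorem continuousOn_chart_symm (v : Δ.V) :
    ContinuousOn (Δ.chart v).symm (Metric.ball (0 : ℂ) 1) := by
  rw [← Δ.chart_target v]
  exact (Δ.chart v).continuousOn_symm

theorem isSimplyConnected_star (v : Δ.V) : IsSimplyConnected (Δ.star v) := by
  have hconv : Convex ℝ (Δ.chart v).target := by
    rw [Δ.chart_target]
    exact convex_ball _ _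
  have hne : (Δ.chart v).target.Nonempty := by
    rw [Δ.chart_target]
    exact ⟨0, by simp⟩
  have : ContractibleSpace (Δ.chart v).target := hconv.contractibleSpace hne
  exact (Δ.chart v).toHomeomorphSourceTarget.toHomotopyEquiv.simplyConnectedSpace

theorem polar_mem_ball (d : ℕ) {ρ : ℝ} (hρ : ρ ∈ Set.Ico (0 : ℝ) 1) (θ : ℝ) :
    (ρ : ℂ) * dir d θ ∈ Metric.ball (0 : ℂ) 1 := by
  rw [mem_ball_zero_iff, norm_mul_dir d hρ.1]
  exact hρ.2

/-- The part of the star of `v` with arguments in `A` (in units of the angle between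
consecutive edges). -/
def sector (v : Δ.V) (A : Set ℝ) : Set S :=
  (fun p : ℝ × ℝ => (Δ.chart v).symm (p.1 * dir (Δ.deg v) p.2)) '' (Set.Ioo 0 1 ×ˢ A)

variable {Δ}

theorem mem_sector {v : Δ.V} {A : Set ℝ} {y : S} :
    y ∈ Δ.sector v A ↔
      y ∈ Δ.star v ∧ ∃ ρ ∈ Set.Ioo (0 : ℝ) 1, ∃ θ ∈ A, Δ.chart v y = ρ * dir (Δ.deg v) θ := by
  constructor
  · rintro ⟨⟨ρ, θ⟩, ⟨hρ, hθ⟩, rfl⟩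
    have hb := polar_mem_ball (Δ.deg v) (Set.Ioo_subset_Ico_self hρ) θ
    exact ⟨Δ.symm_mem_star hb, ρ, hρ, θ, hθ, Δ.chart_symm hb⟩
  · rintro ⟨hy, ρ, hρ, θ, hθ, h⟩
    exact ⟨(ρ, θ), ⟨hρ, hθ⟩, by simp only [← h]; exact (Δ.chart v).left_inv hy⟩

theorem sector_subset_star (v : Δ.V) (A : Set ℝ) : Δ.sector v A ⊆ Δ.star v :=
  fun _ hy => (mem_sector.1 hy).1

theorem sector_mono (v : Δ.V) {A B : Set ℝ} (h : A ⊆ B) : Δ.sector v A ⊆ Δ.sector v B :=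
  Set.image_mono (Set.prod_mono le_rfl h)

/-- The open sector at `v` between the rays `m` and `m + 1`. -/
def sec (Δ : BraneTiling S) (v : Δ.V) (m : ℤ) : Set S := Δ.sector v (Set.Ioo m (m + 1))

/-- The sector `m` at `v` together with the ray on its boundary which is the left-hand side one
(seen from the black end of the edge). -/
def hsec (Δ : BraneTiling S) (v : Δ.V) (m : ℤ) : Set S :=
  match Δ.colour v with
  | Colour.black => Δ.sector v (Set.Ico m (m + 1))
  | Colour.white => Δ.sector v (Set.Ioc m (m + 1))

theorem sec_subset_hsec (v : Δ.V) (m : ℤ) : Δ.sec v m ⊆ Δ.hsec v m := by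
  unfold sec hsec
  split
  · exact sector_mono v Set.Ioo_subset_Ico_self
  · exact sector_mono v Set.Ioo_subset_Ioc_self

theorem sec_subset_star (v : Δ.V) (m : ℤ) : Δ.sec v m ⊆ Δ.star v := sector_subset_star _ _

theorem angle_eq_of_mem_sector {v : Δ.V} {θ θ' : ℝ} {y : S} (h : y ∈ Δ.sector v {θ})
    (h' : y ∈ Δ.sector v {θ'}) : ∃ n : ℤ, θ = θ' + n * Δ.deg v := by
  obtain ⟨-, ρ, hρ, _, rfl, hc⟩ := mem_sector.1 h
  obtain ⟨-, ρ', hρ', _, rfl, hc'⟩ := mem_sector.1 h'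
  exact eq_add_int_mul_of_mul_dir_eq (Δ.degPos v) hρ.1 hρ'.1.le (hc.symm.trans hc')

theorem mem_sector_iff_singleton {v : Δ.V} {A : Set ℝ} {y : S} :
    y ∈ Δ.sector v A ↔ ∃ θ ∈ A, y ∈ Δ.sector v {θ} := by
  constructor
  · rintro ⟨⟨ρ, θ⟩, ⟨hρ, hθ⟩, rfl⟩
    exact ⟨θ, hθ, (ρ, θ), ⟨hρ, rfl⟩, rfl⟩
  · rintro ⟨θ, hθ, h⟩
    exact sector_mono v (by simpa using hθ) h

theorem mem_sector_add {v : Δ.V} {θ : ℝ} {y : S} (h : y ∈ Δ.sector v {θ}) (n : ℤ) :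
    y ∈ Δ.sector v {θ + n * Δ.deg v} := by
  obtain ⟨hy, ρ, hρ, _, rfl, h⟩ := mem_sector.1 h
  exact mem_sector.2 ⟨hy, ρ, hρ, _, rfl, by rwa [dir_add_int_mul (Δ.degPos v)]⟩

theorem sec_add (v : Δ.V) (m n : ℤ) : Δ.sec v (m + n * Δ.deg v) = Δ.sec v m := by
  have key : ∀ m n : ℤ, Δ.sec v m ⊆ Δ.sec v (m + n * Δ.deg v) := by
    intro m n y hy
    obtain ⟨θ, hθ, h⟩ := mem_sector_iff_singleton.1 hy
    refine mem_sector_iff_singleton.2 ⟨_, ?_, mem_sector_add h n⟩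
    push_cast
    constructor <;> linarith [hθ.1, hθ.2]
  refine Set.Subset.antisymm ?_ (key m n)
  have := key (m + n * Δ.deg v) (-n)
  simpa using this

theorem _root_.Tiling.EmbeddedGraph.arcFrom_zero (G : EmbeddedGraph S) (e : G.E) (c : Colour) :
    G.arcFrom e c 0 = G.pt (G.endpt e c) := by
  cases c <;> simp [EmbeddedGraph.arcFrom]

theorem _root_.Tiling.EmbeddedGraph.arcFrom_mem_support (G : EmbeddedGraph S) (e : G.E)
    (c : Colour) (t : I) : G.arcFrom e c t ∈ G.support := by
  refine Or.inr (Set.mem_iUnion.2 ⟨e, ?_⟩)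
  cases c
  · exact ⟨t, rfl⟩
  · exact ⟨σ t, rfl⟩

theorem chart_symm_zero (v : Δ.V) : (Δ.chart v).symm 0 = Δ.pt v := by
  have h := Δ.chart_edge v ⟨0, Δ.deg_pos v⟩ 0 (by simp)
  rw [EmbeddedGraph.arcFrom_zero] at h
  rw [(Δ.edgeAt v ⟨0, Δ.deg_pos v⟩).2] at h
  simpa using h

theorem pt_mem_star (v : Δ.V) : Δ.pt v ∈ Δ.star v := by
  rw [← chart_symm_zero v]
  exact Δ.symm_mem_star (by simp)

theorem mem_sector_ray_iff {v : Δ.V} {k : Fin (Δ.deg v)} {y : S} :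
    y ∈ Δ.sector v {((k : ℕ) : ℝ)} ↔
      ∃ t ∈ Set.Ioo (0 : I) 1, y = Δ.arcFrom (Δ.edgeAt v k).1 (Δ.colour v) t := by
  constructor
  · rintro ⟨⟨ρ, θ⟩, ⟨hρ, rfl⟩, rfl⟩
    exact ⟨⟨ρ, hρ.1.le, hρ.2.le⟩, ⟨hρ.1, hρ.2⟩,
      Δ.chart_edge v k ⟨ρ, hρ.1.le, hρ.2.le⟩ hρ.2⟩
  · rintro ⟨t, ht, rfl⟩
    exact ⟨((t : ℝ), ((k : ℕ) : ℝ)), ⟨⟨ht.1, ht.2⟩, rfl⟩, Δ.chart_edge v k t ht.2⟩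

/-- A point of the graph in the star of `v` is `v` itself or an inner point of an edge at `v`. -/
theorem eq_pt_or_of_mem_support {v : Δ.V} {y : S} (hy : y ∈ Δ.star v)
    (hs : y ∈ Δ.support) : y = Δ.pt v ∨ ∃ k : Fin (Δ.deg v), y ∈ Δ.sector v {((k : ℕ) : ℝ)} := by
  have hb := Δ.chart_mem_ball hy
  have hinv : (Δ.chart v).symm (Δ.chart v y) = y := (Δ.chart v).left_inv hy
  obtain ⟨k, t, h⟩ := Δ.chart_support v _ hb (by rwa [hinv])
  rcases eq_or_lt_of_le t.2.1 with h0 | h0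
  · left
    rw [← hinv, h, ← h0]
    simpa using chart_symm_zero v
  · right
    refine ⟨k, mem_sector.2 ⟨hy, t, ⟨h0, ?_⟩, _, rfl, h⟩⟩
    rwa [h, mem_ball_zero_iff, norm_mul_dir _ h0.le] at hb

/-- In a star, the graph consists of the centre and of rays with integral angles, whereas an angle
strictly between `m` and `m + 1` is not congruent to an integer modulo the degree. -/
theorem sec_disjoint_support {v : Δ.V} {m : ℤ} {y : S} (hy : y ∈ Δ.sec v m) : y ∉ Δ.support := by
  intro hs
  obtain ⟨θ, hθ, h⟩ := mem_sector_iff_singleton.1 hy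
  rcases eq_pt_or_of_mem_support (sec_subset_star v m hy) hs with rfl | ⟨k, hk⟩
  · obtain ⟨-, ρ, hρ, _, -, h⟩ := mem_sector.1 h
    rw [← chart_symm_zero, Δ.chart_symm (by simp)] at h
    have := norm_mul_dir (Δ.deg v) hρ.1.le θ
    simp_all [dir_ne_zero]
  · obtain ⟨n, hn⟩ := angle_eq_of_mem_sector h hk
    have h1 : (m : ℝ) < ((k : ℕ) + n * Δ.deg v : ℤ) := by
      push_cast
      linarith [hθ.1]
    have h2 : (((k : ℕ) + n * Δ.deg v : ℤ) : ℝ) < (m + 1 : ℤ) := by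
      push_cast
      linarith [hθ.2]
    have h3 : m < (k : ℕ) + n * Δ.deg v := by exact_mod_cast h1
    have h4 : ((k : ℕ) : ℤ) + n * Δ.deg v < m + 1 := by exact_mod_cast h2
    omega

theorem ne_pt_exists_sector {v : Δ.V} {y : S} (hy : y ∈ Δ.star v) (hne : y ≠ Δ.pt v) :
    ∃ θ, y ∈ Δ.sector v {θ} := by
  have hb := Δ.chart_mem_ball hy
  have h0 : Δ.chart v y ≠ 0 := by
    intro h
    apply hne
    rw [← (Δ.chart v).left_inv hy, h, chart_symm_zero]
  refine ⟨ang (Δ.deg v) (Δ.chart v y), mem_sector.2 ⟨hy, ‖Δ.chart v y‖, ⟨norm_pos_iff.2 h0, ?_⟩, _,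
    rfl, eq_norm_mul_dir_ang (Δ.degPos v) _⟩⟩
  simpa using hb

theorem exists_mem_sec {v : Δ.V} {y : S} (hy : y ∈ Δ.star v) (hs : y ∉ Δ.support) :
    ∃ m, y ∈ Δ.sec v m := by
  obtain ⟨θ, hθ⟩ := ne_pt_exists_sector hy (fun h => hs (h ▸ Or.inl ⟨v, rfl⟩))
  refine ⟨⌊θ⌋, mem_sector_iff_singleton.2 ⟨θ, ⟨lt_of_le_of_ne (Int.floor_le θ) ?_,
    Int.lt_floor_add_one θ⟩, hθ⟩⟩
  -- If `θ` were an integer, its residue modulo the degree would be the number of a ray through `y`.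
  intro h
  have hd : (0 : ℤ) < Δ.deg v := by exact_mod_cast Δ.degPos v
  have h1 : θ = ((⌊θ⌋ % Δ.deg v).toNat : ℝ) + (⌊θ⌋ / Δ.deg v : ℤ) * Δ.deg v := by
    have h2 := Int.emod_add_mul_ediv ⌊θ⌋ (Δ.deg v)
    have h3 := Int.toNat_of_nonneg (Int.emod_nonneg ⌊θ⌋ hd.ne')
    have h4 : ((⌊θ⌋ % Δ.deg v).toNat : ℝ) = ((⌊θ⌋ % Δ.deg v : ℤ) : ℝ) := by
      exact_mod_cast h3
    rw [h4, ← h]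
    exact_mod_cast (by rw [Int.floor_intCast]; linarith)
  have hlt : (⌊θ⌋ % Δ.deg v).toNat < Δ.deg v := by
    have := Int.emod_lt_of_pos ⌊θ⌋ hd
    omega
  have h5 := mem_sector_add hθ (-(⌊θ⌋ / Δ.deg v))
  have h6 : θ + (-(⌊θ⌋ / Δ.deg v) : ℤ) * Δ.deg v =
      (((⟨_, hlt⟩ : Fin (Δ.deg v)) : ℕ) : ℝ) := by
    push_cast
    linarith
  rw [h6] at h5
  obtain ⟨t, -, rfl⟩ := mem_sector_ray_iff.1 h5
  exact hs (EmbeddedGraph.arcFrom_mem_support _ _ _ _)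

/-- Local polar coordinates, transported by the chart. The last two clauses translate the sides of a
ray, as they appear in `oriented`, into inequalities between angles. -/
theorem mem_nhds_of_mem_sector {v : Δ.V} {θ ε : ℝ} (hε : 0 < ε) {y : S}
    (hy : y ∈ Δ.sector v {θ}) :
    ∀ᶠ x in 𝓝 y, ∃ θ', |θ' - θ| < ε ∧ x ∈ Δ.sector v {θ'} ∧
      (0 < (Δ.chart v x / dir (Δ.deg v) θ).im ↔ θ < θ') ∧
      ((Δ.chart v x / dir (Δ.deg v) θ).im < 0 ↔ θ' < θ) := by
  obtain ⟨hst, ρ, hρ, θ₁, hθ, h⟩ := mem_sector.1 hy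
  obtain rfl : θ₁ = θ := hθ
  have hc : Filter.Tendsto (Δ.chart v) (𝓝 y) (𝓝 (ρ * dir (Δ.deg v) θ₁)) := by
    have := (Δ.chart v).continuousAt hst
    rwa [ContinuousAt, h] at this
  filter_upwards [(Δ.isOpen_star v).mem_nhds hst,
    hc.eventually (eventually_exists_polar (Δ.degPos v) hρ.1 hε)] with x hx hx'
  obtain ⟨θ', h1, h2, h3, h4, h5⟩ := hx'
  exact ⟨θ', h1, mem_sector.2 ⟨hx, _, ⟨h3, by simpa using Δ.chart_mem_ball hx⟩, _, rfl, h2⟩, h4, h5⟩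

theorem isOpen_sec (v : Δ.V) (m : ℤ) : IsOpen (Δ.sec v m) := by
  refine isOpen_iff_mem_nhds.2 fun y hy => ?_
  obtain ⟨θ, hθ, h⟩ := mem_sector_iff_singleton.1 hy
  have hε : 0 < min (θ - m) (m + 1 - θ) := lt_min (by linarith [hθ.1]) (by linarith [hθ.2])
  filter_upwards [mem_nhds_of_mem_sector hε h] with x hx
  obtain ⟨θ', h1, h2, -⟩ := hx
  refine mem_sector_iff_singleton.2 ⟨θ', ?_, h2⟩
  have h3 := lt_min_iff.1 h1
  exact ⟨by linarith [(abs_lt.1 h3.1).1], by linarith [(abs_lt.1 h3.2).2]⟩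

theorem isPathConnected_sec (v : Δ.V) (m : ℤ) : IsPathConnected (Δ.sec v m) := by
  refine IsPathConnected.image' ?_ ?_
  · refine ((convex_Ioo (0 : ℝ) 1).prod (convex_Ioo (m : ℝ) (m + 1))).isPathConnected ?_
    exact ⟨(1 / 2, m + 1 / 2), by constructor <;> constructor <;> norm_num⟩
  · refine (Δ.continuousOn_chart_symm v).comp (by fun_prop) ?_
    rintro ⟨ρ, θ⟩ ⟨hρ, -⟩
    exact polar_mem_ball _ (Set.Ioo_subset_Ico_self hρ) θ

theorem corner_mem_sec (v : Δ.V) (m : ℤ) :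
    (Δ.chart v).symm ((1 / 2 : ℝ) * dir (Δ.deg v) (m + 1 / 2)) ∈ Δ.sec v m :=
  ⟨(1 / 2, m + 1 / 2), by constructor <;> constructor <;> norm_num, rfl⟩

/-- The tile of a point outside of the graph. -/
def tile (Δ : BraneTiling S) (y : S) (hy : y ∉ Δ.support) : Δ.Tile := ConnectedComponents.mk ⟨y, hy⟩

theorem tile_eq_of_path {y y' : S} (p : Path y y') (hp : ∀ t, p t ∉ Δ.support)
    (hy : y ∉ Δ.support) (hy' : y' ∉ Δ.support) : Δ.tile y hy = Δ.tile y' hy' := by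
  let q : Path (⟨y, hy⟩ : ↥(Δ.supportᶜ)) ⟨y', hy'⟩ :=
    { toFun := fun t => ⟨p t, hp t⟩
      continuous_toFun := by fun_prop
      source' := by simp
      target' := by simp }
  exact ConnectedComponents.coe_eq_coe'.2
    (pathComponent_subset_component _ (⟨q.symm⟩ : Joined _ _))

end BraneTiling

end Tiling

/-! ### The two sides of an edge, and paths that cross it. -/

namespace Tiling

namespace BraneTiling

open Topology unitInterval

variable {S : Type*} [TopologicalSpace S] {Δ : BraneTiling S}

/-- The number of an edge in the counterclockwise order at its end of the colour `c`. -/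
def posEnd (Δ : BraneTiling S) (e : Δ.E) (c : Colour) : Fin (Δ.deg (Δ.endpt e c)) :=
  (Δ.edgeAt _).symm ⟨e, by rw [Δ.colour_endpt]⟩

theorem edgeAt_posEnd (e : Δ.E) (c : Colour) :
    (Δ.edgeAt (Δ.endpt e c) (Δ.posEnd e c)).1 = e := by
  simp [posEnd]

/-- Any datum that depends on a vertex and the number of an edge can be computed at the end of
that edge. -/
theorem apply_posEnd {α : Sort*} (f : ∀ v, Fin (Δ.deg v) → α) (v : Δ.V) (k : Fin (Δ.deg v))
    {c : Colour} (hc : Δ.colour v = c) :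
    f (Δ.endpt (Δ.edgeAt v k).1 c) (Δ.posEnd (Δ.edgeAt v k).1 c) = f v k := by
  subst hc
  have key : ∀ (u : Δ.V) (_ : u = v) (e : Δ.E) (he : Δ.endpt e (Δ.colour u) = u)
      (_ : e = (Δ.edgeAt v k).1), f u ((Δ.edgeAt u).symm ⟨e, he⟩) = f v k := by
    rintro u rfl e he rfl
    simp
  exact key _ (Δ.edgeAt v k).2 _ _ rfl

theorem _root_.Tiling.EmbeddedGraph.arcFrom_black (G : EmbeddedGraph S) (e : G.E) {c : Colour}
    (hc : c = Colour.black) (t : I) : G.arcFrom e c t = G.arc e t := by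
  subst hc
  rfl

theorem _root_.Tiling.EmbeddedGraph.arcFrom_white (G : EmbeddedGraph S) (e : G.E) {c : Colour}
    (hc : c = Colour.white) (t : I) : G.arcFrom e c t = G.arc e (σ t) := by
  subst hc
  rfl

theorem isOpen_compl_support [T2Space S] : IsOpen (Δ.support)ᶜ := by
  have h1 : IsCompact (Set.range Δ.pt) := (Set.finite_range _).isCompact
  have h2 : IsCompact (⋃ e, Set.range (Δ.arc e)) :=
    isCompact_iUnion fun e => isCompact_range (Δ.arc e).continuous
  exact (h1.union h2).isClosed.isOpen_compl

theorem exists_mem_star {y : S} (hy : y ∈ Δ.support) : ∃ v, y ∈ Δ.star v := by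
  rcases hy with ⟨v, rfl⟩ | hy
  · exact ⟨v, pt_mem_star v⟩
  · obtain ⟨e, t, rfl⟩ := Set.mem_iUnion.1 hy
    rcases eq_or_ne t 1 with rfl | h1
    · rw [Path.target]
      exact ⟨_, pt_mem_star _⟩
    · refine ⟨Δ.endpt e Colour.black, ?_⟩
      have hlt : t < 1 := lt_of_le_of_ne t.2.2 h1
      have h := Δ.chart_edge _ (Δ.posEnd e Colour.black) t hlt
      rw [edgeAt_posEnd, Δ.colour_endpt] at h
      change (Δ.arcFrom e Colour.black) t ∈ _
      rw [← h]
      exact Δ.symm_mem_star (polar_mem_ball _ ⟨t.2.1, hlt⟩ _)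

theorem arc_mem_sector_black {b : Δ.V} {k : Fin (Δ.deg b)} (hb : Δ.colour b = Colour.black) {t : I}
    (ht : t ∈ Set.Ioo (0 : I) 1) : Δ.arc (Δ.edgeAt b k).1 t ∈ Δ.sector b {((k : ℕ) : ℝ)} :=
  mem_sector_ray_iff.2 ⟨t, ht, (EmbeddedGraph.arcFrom_black _ _ hb t).symm⟩

theorem arc_mem_sector_white {w : Δ.V} {l : Fin (Δ.deg w)} (hw : Δ.colour w = Colour.white) {t : I}
    (ht : t ∈ Set.Ioo (0 : I) 1) : Δ.arc (Δ.edgeAt w l).1 t ∈ Δ.sector w {((l : ℕ) : ℝ)} := by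
  refine mem_sector_ray_iff.2 ⟨σ t, ⟨?_, ?_⟩, ?_⟩
  · rw [← unitInterval.symm_one]
    exact unitInterval.strictAnti_symm ht.2
  · rw [← unitInterval.symm_zero]
    exact unitInterval.strictAnti_symm ht.1
  · rw [EmbeddedGraph.arcFrom_white _ _ hw, unitInterval.symm_symm]

/-- Near an inner point of an edge, the sides of the edge seen from both ends correspond. -/
theorem eventually_sides {b w : Δ.V} {k : Fin (Δ.deg b)} {l : Fin (Δ.deg w)}
    (hb : Δ.colour b = Colour.black) (hw : Δ.colour w = Colour.white)
    (h : (Δ.edgeAt b k).1 = (Δ.edgeAt w l).1) {t : I} (ht : t ∈ Set.Ioo (0 : I) 1) :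
    ∀ᶠ y in 𝓝 (Δ.arc (Δ.edgeAt b k).1 t), ∃ θ η : ℝ, |θ - (k : ℕ)| < 1 / 2 ∧ |η - (l : ℕ)| < 1 / 2 ∧
      y ∈ Δ.sector b {θ} ∧ y ∈ Δ.sector w {η} ∧ (θ = (k : ℕ) ↔ η = (l : ℕ)) ∧
      ((k : ℕ) < θ ↔ η < (l : ℕ)) := by
  have h1 := mem_nhds_of_mem_sector (by norm_num : (0 : ℝ) < 1 / 2)
    (arc_mem_sector_black (k := k) hb ht)
  have h2 := mem_nhds_of_mem_sector (by norm_num : (0 : ℝ) < 1 / 2)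
    (arc_mem_sector_white (l := l) hw ht)
  rw [← h] at h2
  -- Near a ray, lying on it means lying on the graph, a condition that does not depend on the end
  -- of the edge. This settles the equality case, since `oriented` compares only the strict sides.
  have supp : ∀ {v : Δ.V} {j : Fin (Δ.deg v)} {θ : ℝ} {y : S}, |θ - (j : ℕ)| < 1 / 2 →
      y ∈ Δ.sector v {θ} → (θ = (j : ℕ) ↔ y ∈ Δ.support) := by
    intro v j θ y hθ hy
    constructor
    · rintro rfl
      obtain ⟨t, -, rfl⟩ := mem_sector_ray_iff.1 hy
      exact EmbeddedGraph.arcFrom_mem_support _ _ _ _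
    · intro hs
      by_contra hne
      have hab := abs_lt.1 hθ
      rcases lt_or_gt_of_ne hne with hlt | hlt
      · refine sec_disjoint_support (m := (j : ℕ) - 1) (mem_sector_iff_singleton.2 ⟨θ, ?_, hy⟩) hs
        push_cast
        constructor <;> linarith
      · refine sec_disjoint_support (m := (j : ℕ)) (mem_sector_iff_singleton.2 ⟨θ, ?_, hy⟩) hs
        push_cast
        constructor <;> linarith
  filter_upwards [h1, h2, Δ.oriented b w k l hb hw h t ht] with y hy1 hy2 hy3
  obtain ⟨θ, hθ1, hθ2, hθ3, -⟩ := hy1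
  obtain ⟨η, hη1, hη2, -, hη3⟩ := hy2
  exact ⟨θ, η, hθ1, hη1, hθ2, hη2, (supp hθ1 hθ2).trans (supp hη1 hη2).symm,
    hθ3.symm.trans (hy3.trans hη3)⟩

/-- The half-open sectors assign the points of an edge to the same side from both ends. So only two
combinations of sectors occur near an inner point, the edge itself included. -/
theorem eventually_hsec {b w : Δ.V} {k : Fin (Δ.deg b)} {l : Fin (Δ.deg w)}
    (hb : Δ.colour b = Colour.black) (hw : Δ.colour w = Colour.white)
    (h : (Δ.edgeAt b k).1 = (Δ.edgeAt w l).1) {t : I} (ht : t ∈ Set.Ioo (0 : I) 1) :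
    ∀ᶠ y in 𝓝 (Δ.arc (Δ.edgeAt b k).1 t),
      (y ∈ Δ.hsec b (k : ℕ) ∧ y ∈ Δ.hsec w ((l : ℕ) - 1)) ∨
      (y ∈ Δ.hsec b ((k : ℕ) - 1) ∧ y ∈ Δ.hsec w (l : ℕ)) := by
  filter_upwards [eventually_sides hb hw h ht] with y hy
  obtain ⟨θ, η, hθ, hη, hyθ, hyη, h1, h2⟩ := hy
  have hθ' := abs_lt.1 hθ
  have hη' := abs_lt.1 hη
  simp only [hsec, hb, hw]
  by_cases hle : ((k : ℕ) : ℝ) ≤ θ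
  · left
    have hle' : η ≤ (l : ℕ) := by
      rcases eq_or_lt_of_le hle with h0 | h0
      · exact (h1.1 h0.symm).le
      · exact (h2.1 h0).le
    refine ⟨mem_sector_iff_singleton.2 ⟨θ, ?_, hyθ⟩, mem_sector_iff_singleton.2 ⟨η, ?_, hyη⟩⟩ <;>
    · push_cast
      constructor <;> linarith
  · right
    have hle' : ((l : ℕ) : ℝ) < η := by
      by_contra hcon
      rcases eq_or_lt_of_le (not_lt.1 hcon) with h0 | h0
      · exact hle (h1.2 h0).ge
      · exact hle (h2.2 h0).le
    refine ⟨mem_sector_iff_singleton.2 ⟨θ, ?_, hyθ⟩, mem_sector_iff_singleton.2 ⟨η, ?_, hyη⟩⟩ <;>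
    · push_cast
      constructor <;> linarith

theorem exists_ball_subset {v : Δ.V} {y : S} (hy : y ∈ Δ.star v) {N : Set S} (hN : N ∈ 𝓝 y) :
    ∃ ε > 0, Metric.ball (Δ.chart v y) ε ⊆ Metric.ball 0 1 ∧
      (Δ.chart v).symm '' Metric.ball (Δ.chart v y) ε ⊆ N := by
  have hc : ContinuousAt (Δ.chart v).symm (Δ.chart v y) :=
    (Δ.chart v).continuousAt_symm ((Δ.chart v).map_source hy)
  have h1 : (Δ.chart v).symm ⁻¹' N ∈ 𝓝 (Δ.chart v y) :=
    hc.preimage_mem_nhds (by rwa [(Δ.chart v).left_inv hy])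
  have h2 : Metric.ball (0 : ℂ) 1 ∈ 𝓝 (Δ.chart v y) :=
    Metric.isOpen_ball.mem_nhds (Δ.chart_mem_ball hy)
  obtain ⟨ε, hε, h⟩ := Metric.mem_nhds_iff.1 (Filter.inter_mem h1 h2)
  exact ⟨ε, hε, fun z hz => (h hz).2, Set.image_subset_iff.2 fun z hz => (h hz).1⟩

theorem isPathConnected_chart_symm_ball {v : Δ.V} {z : ℂ} {ε : ℝ} (hε : 0 < ε)
    (h : Metric.ball z ε ⊆ Metric.ball 0 1) :
    IsPathConnected ((Δ.chart v).symm '' Metric.ball z ε) :=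
  ((convex_ball z ε).isPathConnected ⟨z, by simpa⟩).image' ((Δ.continuousOn_chart_symm v).mono h)

/-- Every point can be joined, inside a given neighbourhood, to a point outside of the graph. -/
theorem exists_path_to_compl_support {y : S} {N : Set S} (hN : N ∈ 𝓝 y) :
    ∃ (y' : S) (p : Path y y'), y' ∉ Δ.support ∧ ∀ t, p t ∈ N := by
  by_cases hs : y ∈ Δ.support
  swap
  · exact ⟨y, Path.refl y, hs, fun _ => mem_of_mem_nhds hN⟩
  obtain ⟨v, hv⟩ := exists_mem_star hs
  obtain ⟨ε, hε, hb, hsub⟩ := exists_ball_subset hv hN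
  obtain ⟨ρ, hρ, k, hk⟩ : ∃ ρ ∈ Set.Ico (0 : ℝ) 1, ∃ k : ℕ,
      Δ.chart v y = ρ * dir (Δ.deg v) k := by
    obtain ⟨k, t, ht⟩ := Δ.chart_support v _ (Δ.chart_mem_ball hv)
      (by rwa [(Δ.chart v).left_inv hv])
    refine ⟨t, ⟨t.2.1, ?_⟩, k, ht⟩
    have := Δ.chart_mem_ball hv
    rwa [ht, mem_ball_zero_iff, norm_mul_dir _ t.2.1] at this
  -- Increasing the radius and the angle by the same small `δ` leaves the graph from an inner point
  -- of an edge (angle) as well as from a vertex (`ρ = 0`).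
  have hc : ContinuousAt (fun δ : ℝ => ((ρ + δ : ℝ) : ℂ) * dir (Δ.deg v) (k + δ)) 0 := by
    fun_prop
  have hmem : ∀ᶠ δ in 𝓝 (0 : ℝ),
      ((ρ + δ : ℝ) : ℂ) * dir (Δ.deg v) (k + δ) ∈ Metric.ball (Δ.chart v y) ε := by
    refine hc.eventually (Metric.isOpen_ball.mem_nhds ?_)
    simpa [hk] using hε
  have hlt : ∀ᶠ δ in 𝓝 (0 : ℝ), δ < min 1 (1 - ρ) :=
    gt_mem_nhds (lt_min one_pos (by linarith [hρ.2]))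
  obtain ⟨δ, ⟨hδ1, hδ2⟩, hδ0⟩ := (((hmem.and hlt).filter_mono nhdsWithin_le_nhds).and
    (self_mem_nhdsWithin : Set.Ioi (0 : ℝ) ∈ 𝓝[>] 0)).exists
  have hδ0 : 0 < δ := hδ0
  obtain ⟨hδ3, hδ4⟩ := lt_min_iff.1 hδ2
  have hj := (isPathConnected_chart_symm_ball (v := v) hε hb).joinedIn y
    ⟨_, Metric.mem_ball_self hε, (Δ.chart v).left_inv hv⟩ _ ⟨_, hδ1, rfl⟩
  refine ⟨_, hj.somePath, sec_disjoint_support (v := v) (m := k) ?_, fun t => hsub (hj.somePath_mem t)⟩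
  exact ⟨(ρ + δ, k + δ), ⟨⟨by linarith [hρ.1], by linarith⟩, by push_cast; constructor <;> simp <;> linarith⟩, rfl⟩

/-- A path that crosses an edge. -/
theorem exists_crossing {b w : Δ.V} {k : Fin (Δ.deg b)} {l : Fin (Δ.deg w)}
    (hb : Δ.colour b = Colour.black) (hw : Δ.colour w = Colour.white)
    (h : (Δ.edgeAt b k).1 = (Δ.edgeAt w l).1) :
    ∃ (y y' : S) (p : Path y y'), (∀ t, p t ∈ Δ.star b ∩ Δ.star w) ∧
      y ∈ Δ.sec b (k : ℕ) ∧ y ∈ Δ.sec w ((l : ℕ) - 1) ∧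
      y' ∈ Δ.sec b ((k : ℕ) - 1) ∧ y' ∈ Δ.sec w (l : ℕ) := by
  have ht : (⟨1 / 2, by norm_num, by norm_num⟩ : I) ∈ Set.Ioo (0 : I) 1 :=
    ⟨Subtype.mk_lt_mk.2 (by norm_num), Subtype.mk_lt_mk.2 (by norm_num)⟩
  generalize (⟨1 / 2, by norm_num, by norm_num⟩ : I) = t at ht
  have hxb := arc_mem_sector_black (k := k) hb ht
  have hxw := arc_mem_sector_white (l := l) hw ht
  rw [← h] at hxw
  have hsides := eventually_sides hb hw h ht
  generalize Δ.arc (Δ.edgeAt b k).1 t = x at hxb hxw hsides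
  obtain ⟨hxst, ρ, hρ, θ, hθ, hx⟩ := mem_sector.1 hxb
  obtain rfl : θ = (k : ℕ) := hθ
  have hN := Filter.inter_mem hsides (Filter.inter_mem ((Δ.isOpen_star b).mem_nhds hxst)
    ((Δ.isOpen_star w).mem_nhds (sector_subset_star _ _ hxw)))
  obtain ⟨ε, hε, hball, hsub⟩ := exists_ball_subset hxst hN
  have hc : ContinuousAt (fun δ : ℝ => (ρ : ℂ) * dir (Δ.deg b) ((k : ℕ) + δ)) 0 := by
    fun_prop
  have hmem : ∀ᶠ δ in 𝓝 (0 : ℝ),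
      (ρ : ℂ) * dir (Δ.deg b) ((k : ℕ) + δ) ∈ Metric.ball (Δ.chart b x) ε := by
    refine hc.eventually (Metric.isOpen_ball.mem_nhds ?_)
    simpa [hx] using hε
  obtain ⟨r, hr, hrs⟩ := Metric.eventually_nhds_iff.1 hmem
  have hδ : 0 < min (r / 2) (1 / 4) := by positivity
  have hδ1 : min (r / 2) (1 / 4) ≤ 1 / 4 := min_le_right _ _
  have hδ2 : min (r / 2) (1 / 4) < r := (min_le_left _ _).trans_lt (by linarith)
  generalize min (r / 2) (1 / 4) = δ at hδ hδ1 hδ2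
  have hd1 : (1 : ℝ) ≤ Δ.deg b := by exact_mod_cast Δ.degPos b
  have key : ∀ δ' : ℝ, |δ'| = δ →
      (Δ.chart b).symm (ρ * dir (Δ.deg b) ((k : ℕ) + δ')) ∈ Δ.sector b {(k : ℕ) + δ'} ∧
      (Δ.chart b).symm (ρ * dir (Δ.deg b) ((k : ℕ) + δ')) ∈
        (Δ.chart b).symm '' Metric.ball (Δ.chart b x) ε ∧
      ∃ η : ℝ, |η - (l : ℕ)| < 1 / 2 ∧
        (Δ.chart b).symm (ρ * dir (Δ.deg b) ((k : ℕ) + δ')) ∈ Δ.sector w {η} ∧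
        (δ' = 0 ↔ η = (l : ℕ)) ∧ (0 < δ' ↔ η < (l : ℕ)) := by
    intro δ' hδ'
    have h1 : (Δ.chart b).symm (ρ * dir (Δ.deg b) ((k : ℕ) + δ')) ∈ Δ.sector b {(k : ℕ) + δ'} :=
      ⟨(ρ, (k : ℕ) + δ'), ⟨hρ, rfl⟩, rfl⟩
    have h2 : (Δ.chart b).symm (ρ * dir (Δ.deg b) ((k : ℕ) + δ')) ∈
        (Δ.chart b).symm '' Metric.ball (Δ.chart b x) ε :=
      ⟨_, hrs (by simpa [hδ'] using hδ2), rfl⟩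
    obtain ⟨⟨θ, η, hθ, hη, hyθ, hyη, h3, h4⟩, -⟩ := hsub h2
    obtain ⟨n, hn⟩ := angle_eq_of_mem_sector hyθ h1
    -- The angles `θ` and `k + δ'` differ by less than `1`, but a nonzero multiple of the degree is
    -- at least `1` in absolute value.
    have hn0 : n = 0 := by
      by_contra hne
      have h5 : (1 : ℝ) ≤ |(n : ℝ)| := by
        exact_mod_cast Int.one_le_abs hne
      have h6 : (1 : ℝ) ≤ |(n : ℝ) * Δ.deg b| := by
        rw [abs_mul, abs_of_nonneg (by positivity : (0 : ℝ) ≤ Δ.deg b)]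
        nlinarith
      have h7 : (n : ℝ) * Δ.deg b = (θ - (k : ℕ)) - δ' := by linarith
      rw [h7] at h6
      have := abs_sub (θ - (k : ℕ)) δ'
      linarith
    rw [hn0] at hn
    have hθ' : θ = (k : ℕ) + δ' := by simpa using hn
    subst hθ'
    exact ⟨h1, h2, η, hη, hyη, by simpa using h3, by simpa using h4⟩
  obtain ⟨hL1, hL2, η, hη1, hη2, -, hη4⟩ := key δ (abs_of_pos hδ)
  obtain ⟨hR1, hR2, ζ, hζ1, hζ2, hζ3, hζ4⟩ := key (-δ) (by rw [abs_neg, abs_of_pos hδ])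
  have hj := (isPathConnected_chart_symm_ball hε hball).joinedIn _ hL2 _ hR2
  have hη5 := hη4.1 hδ
  have hζ5 : ((l : ℕ) : ℝ) < ζ := by
    refine lt_of_le_of_ne (not_lt.1 fun h0 => ?_) fun h0 => ?_
    · linarith [hζ4.2 h0]
    · linarith [hζ3.2 h0.symm]
  have hη' := abs_lt.1 hη1
  have hζ' := abs_lt.1 hζ1
  refine ⟨_, _, hj.somePath, fun t => (hsub (hj.somePath_mem t)).2,
    mem_sector_iff_singleton.2 ⟨_, ?_, hL1⟩, mem_sector_iff_singleton.2 ⟨_, ?_, hη2⟩,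
    mem_sector_iff_singleton.2 ⟨_, ?_, hR1⟩, mem_sector_iff_singleton.2 ⟨_, ?_, hζ2⟩⟩ <;>
  · push_cast
    constructor <;> linarith

end BraneTiling

end Tiling

/-! ### Loops at the base point made from path classes. -/

section LoopOf

variable {X : Type*} [TopologicalSpace X] {x₀ : X}

/-- The loop at `x₀` obtained from a path class by means of fixed path classes from `x₀` to all
points. -/
noncomputable def loopOf (β : ∀ y, Path.Homotopic.Quotient x₀ y) {y y' : X}
    (γ : Path.Homotopic.Quotient y y') : FundamentalGroup X x₀ :=
  FundamentalGroup.fromPath ((β y).trans (γ.trans (β y').symm))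

/-- The inner `β y'` cancels. Products in the fundamental group are read from right to left, just as
the words of the path algebra. -/
theorem loopOf_trans (β : ∀ y, Path.Homotopic.Quotient x₀ y) {y y' y'' : X}
    (γ : Path.Homotopic.Quotient y y') (γ' : Path.Homotopic.Quotient y' y'') :
    loopOf β (γ.trans γ') = loopOf β γ' * loopOf β γ := by
  change (β y).trans ((γ.trans γ').trans (β y'').symm) =
    ((β y).trans (γ.trans (β y').symm)).trans ((β y').trans (γ'.trans (β y'').symm))
  simp only [Path.Homotopic.Quotient.trans_assoc]
  rw [← Path.Homotopic.Quotient.trans_assoc (β y').symm (β y'),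
    Path.Homotopic.Quotient.symm_trans, Path.Homotopic.Quotient.refl_trans]

theorem loopOf_eq_one {β : ∀ y, Path.Homotopic.Quotient x₀ y} {y y' : X}
    {γ : Path.Homotopic.Quotient y y'} (h : (β y).trans γ = β y') : loopOf β γ = 1 := by
  change (β y).trans (γ.trans (β y').symm) = Path.Homotopic.Quotient.refl x₀
  rw [← Path.Homotopic.Quotient.trans_assoc, h, Path.Homotopic.Quotient.trans_symm]

theorem exists_loopOf_eq (β : ∀ y, Path.Homotopic.Quotient x₀ y) (y y' : X)
    (g : FundamentalGroup X x₀) : ∃ γ : Path.Homotopic.Quotient y y', loopOf β γ = g := by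
  refine ⟨(β y).symm.trans ((FundamentalGroup.toPath g).trans (β y')), ?_⟩
  change (β y).trans (((β y).symm.trans ((FundamentalGroup.toPath g).trans (β y'))).trans
    (β y').symm) = FundamentalGroup.toPath g
  simp only [Path.Homotopic.Quotient.trans_assoc]
  rw [← Path.Homotopic.Quotient.trans_assoc (β y) (β y).symm,
    Path.Homotopic.Quotient.trans_symm, Path.Homotopic.Quotient.refl_trans,
    Path.Homotopic.Quotient.trans_symm, Path.Homotopic.Quotient.trans_refl]

end LoopOf

/-! ### Dual loops and turns around vertices. -/

namespace Tiling

namespace BraneTiling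

open Topology unitInterval

variable {S : Type*} [TopologicalSpace S] {Δ : BraneTiling S}

/-- The path classes `β` are compatible with paths inside the tiles. -/
def IsTileCompatible (Δ : BraneTiling S) {x₀ : S} (β : ∀ y, Path.Homotopic.Quotient x₀ y) : Prop :=
  ∀ ⦃y y' : S⦄ (p : Path y y'), (∀ t, p t ∉ Δ.support) → (β y).trans (.mk p) = β y'

/-- Choose a base point in each tile and a path to it from `x₀`, and continue inside the tile. As
tiles are simply connected, the class of the continuation does not depend on choices. -/
theorem exists_isTileCompatible [PathConnectedSpace S] (x₀ : S) :
    ∃ β : ∀ y, Path.Homotopic.Quotient x₀ y, Δ.IsTileCompatible β := by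
  classical
  have hsc : ∀ a : ↥(Δ.supportᶜ), IsSimplyConnected (Subtype.val '' connectedComponent a) :=
    fun a => Topology.IsEmbedding.subtypeVal.isSimplyConnected_image.2 (Δ.simplyConnected_tile a)
  let base : Δ.Tile → ↥(Δ.supportᶜ) := Function.surjInv ConnectedComponents.surjective_coe
  have hbase : ∀ y (hy : y ∉ Δ.support),
      y ∈ Subtype.val '' connectedComponent (base (Δ.tile y hy)) := by
    intro y hy
    refine ⟨⟨y, hy⟩, ?_, rfl⟩
    have h : (ConnectedComponents.mk (base (Δ.tile y hy)) : Δ.Tile) = Δ.tile y hy :=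
      Function.surjInv_eq ConnectedComponents.surjective_coe _
    exact ConnectedComponents.coe_eq_coe'.1 h.symm
  let κ : ∀ y (hy : y ∉ Δ.support), Path (base (Δ.tile y hy) : S) y := fun y hy =>
    ((hsc _).isPathConnected.joinedIn _ ⟨_, mem_connectedComponent, rfl⟩ _ (hbase y hy)).somePath
  have hκ : ∀ y (hy : y ∉ Δ.support) t,
      κ y hy t ∈ Subtype.val '' connectedComponent (base (Δ.tile y hy)) :=
    fun y hy => JoinedIn.somePath_mem _
  -- On the graph itself the class is arbitrary, because compatibility concerns only paths outside
  -- of it.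
  refine ⟨fun y => if hy : y ∉ Δ.support then
    (Path.Homotopic.Quotient.mk (PathConnectedSpace.somePath x₀ (base (Δ.tile y hy) : S))).trans
      (.mk (κ y hy)) else .mk (PathConnectedSpace.somePath x₀ y), ?_⟩
  intro y y' p hp
  have hy : y ∉ Δ.support := by simpa using hp 0
  have hy' : y' ∉ Δ.support := by simpa using hp 1
  have htile : ∀ t, Δ.tile (p t) (hp t) = Δ.tile y hy := by
    intro t
    rw [← tile_eq_of_path (p.subpath 0 t) (fun s => hp _) (hp 0) (hp t)]
    simp
  have htile' : Δ.tile y' hy' = Δ.tile y hy := by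
    have := htile 1
    simpa using this
  -- The tile of `y'` is replaced by a variable, so that its equality with the tile of `y` can be
  -- substituted in the types of the paths.
  have key : ∀ (T : Δ.Tile) (hT : T = Δ.tile y hy) (q : Path (base T : S) y'),
      (∀ t, q t ∈ Subtype.val '' connectedComponent (base T)) →
      ((Path.Homotopic.Quotient.mk (PathConnectedSpace.somePath x₀ (base (Δ.tile y hy) : S))).trans
        (.mk (κ y hy))).trans (.mk p) =
      (Path.Homotopic.Quotient.mk (PathConnectedSpace.somePath x₀ (base T : S))).trans (.mk q) := by
    rintro _ rfl q hq
    rw [Path.Homotopic.Quotient.trans_assoc, ← Path.Homotopic.Quotient.mk_trans]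
    congr 1
    refine (hsc _).mk_eq _ _ (fun t => ?_) hq
    have : ((κ y hy).trans p) t ∈ Set.range (κ y hy) ∪ Set.range p := by
      rw [← Path.trans_range]
      exact ⟨t, rfl⟩
    rcases this with ⟨s, hs⟩ | ⟨s, hs⟩
    · rw [← hs]
      exact hκ y hy s
    · rw [← hs, ← htile s]
      exact hbase _ (hp s)
  simp only [hy, hy', not_false_eq_true, dite_true]
  exact key _ htile' _ (hκ y' hy')

variable {x₀ : S} {β : ∀ y, Path.Homotopic.Quotient x₀ y}

theorem IsTileCompatible.loopOf_eq_one (hβ : Δ.IsTileCompatible β) {y y' : S} (p : Path y y')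
    (hp : ∀ t, p t ∉ Δ.support) : loopOf β (.mk p) = 1 :=
  _root_.loopOf_eq_one (hβ p hp)

theorem tile_eq_corner {v : Δ.V} {m : ℤ} {y : S} (hy : y ∈ Δ.sec v m) :
    Δ.tile y (sec_disjoint_support hy) = Δ.corner v m := by
  have hj := (isPathConnected_sec v m).joinedIn y hy _ (corner_mem_sec v m)
  exact tile_eq_of_path hj.somePath (fun t => sec_disjoint_support (hj.somePath_mem t)) _ _

/-- A path inside the star of `v`. -/
noncomputable def starPath (v : Δ.V) {y y' : S} (hy : y ∈ Δ.star v) (hy' : y' ∈ Δ.star v) :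
    Path y y' :=
  ((Δ.isSimplyConnected_star v).isPathConnected.joinedIn y hy y' hy').somePath

theorem starPath_mem (v : Δ.V) {y y' : S} (hy : y ∈ Δ.star v) (hy' : y' ∈ Δ.star v) (t : I) :
    starPath v hy hy' t ∈ Δ.star v :=
  JoinedIn.somePath_mem _ t

/-- The loop which runs through the star of `v`, from the sector `m` to the sector `m'`. -/
noncomputable def turn (Δ : BraneTiling S) (β : ∀ y, Path.Homotopic.Quotient x₀ y) (v : Δ.V)
    (m m' : ℤ) : FundamentalGroup S x₀ :=
  loopOf β (.mk (starPath v (sec_subset_star v m (corner_mem_sec v m))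
    (sec_subset_star v m' (corner_mem_sec v m'))))

theorem trans_mem {A : Set S} {y y' y'' : S} {p : Path y y'} {q : Path y' y''}
    (hp : ∀ t, p t ∈ A) (hq : ∀ t, q t ∈ A) (t : I) : p.trans q t ∈ A := by
  have : p.trans q t ∈ Set.range p ∪ Set.range q := by
    rw [← Path.trans_range]
    exact ⟨t, rfl⟩
  rcases this with ⟨s, hs⟩ | ⟨s, hs⟩ <;> rw [← hs]
  exacts [hp s, hq s]

/-- Only the sectors of the ends matter: moving an end within its sector avoids the graph and
contributes `1`, and paths with the same ends in the simply connected star are homotopic. -/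
theorem loopOf_eq_turn (hβ : Δ.IsTileCompatible β) {v : Δ.V} {m m' : ℤ} {y y' : S}
    (hy : y ∈ Δ.sec v m) (hy' : y' ∈ Δ.sec v m') (p : Path y y') (hp : ∀ t, p t ∈ Δ.star v) :
    loopOf β (.mk p) = Δ.turn β v m m' := by
  have hj := (isPathConnected_sec v m).joinedIn _ (corner_mem_sec v m) y hy
  have hj' := (isPathConnected_sec v m').joinedIn _ (corner_mem_sec v m') y' hy'
  have h := (Δ.isSimplyConnected_star v).mk_eq (hj.somePath.trans p)
    ((starPath v (sec_subset_star v m (corner_mem_sec v m))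
      (sec_subset_star v m' (corner_mem_sec v m'))).trans hj'.somePath)
    (trans_mem (fun t => sec_subset_star _ _ (hj.somePath_mem t)) hp)
    (trans_mem (starPath_mem _ _ _) (fun t => sec_subset_star _ _ (hj'.somePath_mem t)))
  have h2 := congrArg (loopOf β) h
  rw [Path.Homotopic.Quotient.mk_trans, Path.Homotopic.Quotient.mk_trans, loopOf_trans,
    loopOf_trans, hβ.loopOf_eq_one hj.somePath fun t => sec_disjoint_support (hj.somePath_mem t),
    hβ.loopOf_eq_one hj'.somePath fun t => sec_disjoint_support (hj'.somePath_mem t),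
    mul_one, one_mul] at h2
  exact h2

theorem turn_mul (hβ : Δ.IsTileCompatible β) (v : Δ.V) (m m' m'' : ℤ) :
    Δ.turn β v m' m'' * Δ.turn β v m m' = Δ.turn β v m m'' := by
  conv_lhs => unfold turn
  rw [← loopOf_trans, ← Path.Homotopic.Quotient.mk_trans]
  exact loopOf_eq_turn hβ (corner_mem_sec v m) (corner_mem_sec v m'') _
    (trans_mem (starPath_mem _ _ _) (starPath_mem _ _ _))

theorem turn_self (hβ : Δ.IsTileCompatible β) (v : Δ.V) (m : ℤ) : Δ.turn β v m m = 1 :=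
  mul_eq_left.1 (turn_mul hβ v m m m)

theorem turn_inv (hβ : Δ.IsTileCompatible β) (v : Δ.V) (m m' : ℤ) :
    (Δ.turn β v m m')⁻¹ = Δ.turn β v m' m := by
  rw [inv_eq_iff_mul_eq_one, turn_mul hβ, turn_self hβ]

theorem turn_add (hβ : Δ.IsTileCompatible β) (v : Δ.V) (m m' n : ℤ) :
    Δ.turn β v m (m' + n * Δ.deg v) = Δ.turn β v m m' := by
  refine loopOf_eq_turn hβ (corner_mem_sec v m) ?_ _ (starPath_mem _ _ _)
  rw [← sec_add v m' n]
  exact corner_mem_sec v _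

/-- The loop dual to an edge. -/
noncomputable def dualLoop (Δ : BraneTiling S) (β : ∀ y, Path.Homotopic.Quotient x₀ y) (e : Δ.E) :
    FundamentalGroup S x₀ :=
  Δ.turn β (Δ.endpt e Colour.black) (Δ.posEnd e Colour.black : ℕ)
    ((Δ.posEnd e Colour.black : ℕ) - 1)

theorem exists_crossing_edge (e : Δ.E) :
    ∃ (y y' : S) (p : Path y y'),
      (∀ t, p t ∈ Δ.star (Δ.endpt e Colour.black) ∩ Δ.star (Δ.endpt e Colour.white)) ∧
      y ∈ Δ.sec (Δ.endpt e Colour.black) (Δ.posEnd e Colour.black : ℕ) ∧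
      y ∈ Δ.sec (Δ.endpt e Colour.white) ((Δ.posEnd e Colour.white : ℕ) - 1) ∧
      y' ∈ Δ.sec (Δ.endpt e Colour.black) ((Δ.posEnd e Colour.black : ℕ) - 1) ∧
      y' ∈ Δ.sec (Δ.endpt e Colour.white) (Δ.posEnd e Colour.white : ℕ) :=
  exists_crossing (Δ.colour_endpt e _) (Δ.colour_endpt e _)
    ((edgeAt_posEnd e _).trans (edgeAt_posEnd e _).symm)

/-- A short path across the edge lies in both stars and computes both turns. By the orientation
condition, clockwise around the black end is counterclockwise around the white one. -/
theorem dualLoop_eq_turn_white (hβ : Δ.IsTileCompatible β) (e : Δ.E) :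
    Δ.dualLoop β e = Δ.turn β (Δ.endpt e Colour.white) ((Δ.posEnd e Colour.white : ℕ) - 1)
      (Δ.posEnd e Colour.white : ℕ) := by
  obtain ⟨y, y', p, hp, h1, h2, h3, h4⟩ := exists_crossing_edge e
  rw [dualLoop, ← loopOf_eq_turn hβ h1 h3 p fun t => (hp t).1,
    loopOf_eq_turn hβ h2 h4 p fun t => (hp t).2]

theorem dualLoop_of_black {v : Δ.V} (hv : Δ.colour v = Colour.black) (k : Fin (Δ.deg v)) :
    Δ.dualLoop β (Δ.edgeAt v k).1 = Δ.turn β v (k : ℕ) ((k : ℕ) - 1) :=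
  apply_posEnd (fun v k => Δ.turn β v (k : ℕ) ((k : ℕ) - 1)) v k hv

theorem dualLoop_of_white (hβ : Δ.IsTileCompatible β) {v : Δ.V} (hv : Δ.colour v = Colour.white)
    (k : Fin (Δ.deg v)) :
    Δ.dualLoop β (Δ.edgeAt v k).1 = Δ.turn β v ((k : ℕ) - 1) (k : ℕ) :=
  (dualLoop_eq_turn_white hβ _).trans
    (apply_posEnd (fun v k => Δ.turn β v ((k : ℕ) - 1) (k : ℕ)) v k hv)

theorem source_of_black {v : Δ.V} (hv : Δ.colour v = Colour.black) (k : Fin (Δ.deg v)) :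
    Δ.quiver.s (Δ.edgeAt v k).1 = Δ.corner v (k : ℕ) :=
  apply_posEnd (fun v k => Δ.corner v (k : ℕ)) v k hv

theorem target_of_black {v : Δ.V} (hv : Δ.colour v = Colour.black) (k : Fin (Δ.deg v)) :
    Δ.quiver.t (Δ.edgeAt v k).1 = Δ.corner v ((k : ℕ) - 1) :=
  apply_posEnd (fun v k => Δ.corner v ((k : ℕ) - 1)) v k hv

theorem source_of_white {v : Δ.V} (hv : Δ.colour v = Colour.white) (k : Fin (Δ.deg v)) :
    Δ.quiver.s (Δ.edgeAt v k).1 = Δ.corner v ((k : ℕ) - 1) := by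
  refine Eq.trans ?_ (apply_posEnd (fun v k => Δ.corner v ((k : ℕ) - 1)) v k hv)
  obtain ⟨y, y', p, hp, h1, h2, h3, h4⟩ := exists_crossing_edge (Δ.edgeAt v k).1
  exact (tile_eq_corner h1).symm.trans (tile_eq_corner h2)

theorem target_of_white {v : Δ.V} (hv : Δ.colour v = Colour.white) (k : Fin (Δ.deg v)) :
    Δ.quiver.t (Δ.edgeAt v k).1 = Δ.corner v (k : ℕ) := by
  refine Eq.trans ?_ (apply_posEnd (fun v k => Δ.corner v (k : ℕ)) v k hv)
  obtain ⟨y, y', p, hp, h1, h2, h3, h4⟩ := exists_crossing_edge (Δ.edgeAt v k).1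
  exact (tile_eq_corner h3).symm.trans (tile_eq_corner h4)

theorem corner_add (v : Δ.V) (m n : ℤ) : Δ.corner v (m + n * Δ.deg v) = Δ.corner v m := by
  have h := corner_mem_sec v (m + n * Δ.deg v)
  have h' := h
  rw [sec_add] at h'
  exact (tile_eq_corner h).symm.trans (tile_eq_corner h')

/-- The edges at `v`, in the order of the word `c_v`. -/
def cycWord (Δ : BraneTiling S) (v : Δ.V) : List Δ.E :=
  match Δ.colour v with
  | Colour.black => List.ofFn fun k => (Δ.edgeAt v k).1
  | Colour.white => (List.ofFn fun k => (Δ.edgeAt v k).1).reverse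

theorem cycWord_black {v : Δ.V} (hv : Δ.colour v = Colour.black) :
    Δ.cycWord v = List.ofFn fun k => (Δ.edgeAt v k).1 := by
  simp only [cycWord, hv]

theorem cycWord_white {v : Δ.V} (hv : Δ.colour v = Colour.white) :
    Δ.cycWord v = (List.ofFn fun k => (Δ.edgeAt v k).1).reverse := by
  simp only [cycWord, hv]

theorem cyc_eq (v : Δ.V) : Δ.cyc v = (Δ.cycWord v : Cycle Δ.E) := by
  cases hv : Δ.colour v with
  | black =>
    rw [cycWord_black hv]
    simp only [cyc, hv]
  | white =>
    rw [cycWord_white hv]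
    simp only [cyc, hv]

/-- The contribution of the `k`-th edge at `v` to a counterclockwise turn around `v`. -/
def ccwStep {G : Type*} [Group G] (a : Δ.E → G) (v : Δ.V) (k : Fin (Δ.deg v)) : G :=
  match Δ.colour v with
  | Colour.black => (a (Δ.edgeAt v k).1)⁻¹
  | Colour.white => a (Δ.edgeAt v k).1

theorem ccwStep_black {G : Type*} [Group G] (a : Δ.E → G) {v : Δ.V}
    (hv : Δ.colour v = Colour.black) (k : Fin (Δ.deg v)) :
    ccwStep a v k = (a (Δ.edgeAt v k).1)⁻¹ := by
  simp only [ccwStep, hv]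

theorem ccwStep_white {G : Type*} [Group G] (a : Δ.E → G) {v : Δ.V}
    (hv : Δ.colour v = Colour.white) (k : Fin (Δ.deg v)) :
    ccwStep a v k = a (Δ.edgeAt v k).1 := by
  simp only [ccwStep, hv]

/-- At a black vertex `c_v` runs clockwise, so the product is inverted. Afterwards both colours can
be treated by the same counterclockwise recursion on the sectors. -/
theorem prod_cycWord_eq_one_iff {G : Type*} [Group G] (a : Δ.E → G) (v : Δ.V) :
    ((Δ.cycWord v).map a).prod = 1 ↔ (List.ofFn (ccwStep a v)).reverse.prod = 1 := by
  cases hv : Δ.colour v with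
  | black =>
    rw [← inv_eq_one, List.prod_inv_reverse, cycWord_black hv, List.map_ofFn, List.map_ofFn,
      funext (ccwStep_black a hv)]
    rfl
  | white =>
    rw [cycWord_white hv, List.map_reverse, List.map_ofFn, funext (ccwStep_white a hv)]
    rfl

/-- The dual loops satisfy the relations `c_v = 1`: the turns from the sector `0` form a periodic
potential for them. -/
theorem prod_dualLoop_cycWord (hβ : Δ.IsTileCompatible β) (v : Δ.V) :
    ((Δ.cycWord v).map (Δ.dualLoop β)).prod = 1 := by
  rw [prod_cycWord_eq_one_iff]
  refine prod_reverse_ofFn_of_potential _ (fun m => Δ.turn β v 0 m) ?_ fun k => ?_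
  · have := turn_add hβ v 0 (-1) 1
    rw [← this]
    congr 1
    ring
  · have : ccwStep (Δ.dualLoop β) v k = Δ.turn β v ((k : ℕ) - 1) (k : ℕ) := by
      cases hv : Δ.colour v with
      | black => rw [ccwStep_black _ hv, dualLoop_of_black hv, turn_inv hβ]
      | white => rw [ccwStep_white _ hv, dualLoop_of_white hβ hv]
    rw [this, turn_mul hβ]

end BraneTiling

end Tiling

/-! ### Generation of the fundamental groupoid by the dual loops. -/

namespace Tiling

namespace BraneTiling

open Topology unitInterval

variable {S : Type*} [TopologicalSpace S] {Δ : BraneTiling S}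
variable {x₀ : S} {β : ∀ y, Path.Homotopic.Quotient x₀ y}

/-- The open cover of the surface by the complement of the graph and the stars of the vertices. -/
def coverSet (Δ : BraneTiling S) : Option Δ.V → Set S
  | none => (Δ.support)ᶜ
  | some v => Δ.star v

theorem isOpen_coverSet [T2Space S] (i : Option Δ.V) : IsOpen (Δ.coverSet i) := by
  cases i with
  | none => exact isOpen_compl_support
  | some v => exact Δ.isOpen_star v

theorem exists_mem_coverSet (Δ : BraneTiling S) (y : S) : ∃ i, y ∈ Δ.coverSet i := by
  by_cases hy : y ∈ Δ.support
  · obtain ⟨v, hv⟩ := exists_mem_star hy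
    exact ⟨some v, hv⟩
  · exact ⟨none, hy⟩

theorem colour_eq_or (v : Δ.V) : Δ.colour v = Colour.black ∨ Δ.colour v = Colour.white := by
  cases Δ.colour v <;> simp

section Generation

variable {P : Δ.Tile → Δ.Tile → FundamentalGroup S x₀ → Prop}

/-- A turn is composed of turns past single rays, and each of these is a dual loop or the inverse of
one. -/
theorem turn_mem_of_dualLoop_mem (hβ : Δ.IsTileCompatible β)
    (hone : ∀ T, P T T 1)
    (hmul : ∀ T T' T'' g g', P T T' g → P T' T'' g' → P T T'' (g' * g))
    (hd : ∀ e, P (Δ.quiver.s e) (Δ.quiver.t e) (Δ.dualLoop β e))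
    (hd' : ∀ e, P (Δ.quiver.t e) (Δ.quiver.s e) (Δ.dualLoop β e)⁻¹) (v : Δ.V) (m m' : ℤ) :
    P (Δ.corner v m) (Δ.corner v m') (Δ.turn β v m m') := by
  have hk : ∀ k : Fin (Δ.deg v),
      P (Δ.corner v ((k : ℕ) - 1)) (Δ.corner v (k : ℕ)) (Δ.turn β v ((k : ℕ) - 1) (k : ℕ)) ∧
      P (Δ.corner v (k : ℕ)) (Δ.corner v ((k : ℕ) - 1)) (Δ.turn β v (k : ℕ) ((k : ℕ) - 1)) := by
    intro k
    have h1 := hd (Δ.edgeAt v k).1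
    have h2 := hd' (Δ.edgeAt v k).1
    cases hv : Δ.colour v with
    | black =>
      rw [source_of_black hv, target_of_black hv, dualLoop_of_black hv] at h1 h2
      rw [turn_inv hβ] at h2
      exact ⟨h2, h1⟩
    | white =>
      rw [source_of_white hv, target_of_white hv, dualLoop_of_white hβ hv] at h1 h2
      rw [turn_inv hβ] at h2
      exact ⟨h1, h2⟩
  -- The sectors `m` and `m + 1` are separated by the ray `m + 1`, whose number has to be reduced
  -- modulo the degree.
  have hstep : ∀ m : ℤ, P (Δ.corner v m) (Δ.corner v (m + 1)) (Δ.turn β v m (m + 1)) ∧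
      P (Δ.corner v (m + 1)) (Δ.corner v m) (Δ.turn β v (m + 1) m) := by
    intro m
    have hd0 : (0 : ℤ) < Δ.deg v := by exact_mod_cast Δ.degPos v
    have hlt : ((m + 1) % Δ.deg v).toNat < Δ.deg v := by
      have := Int.emod_lt_of_pos (m + 1) hd0
      omega
    have hcast : ((((m + 1) % Δ.deg v).toNat : ℕ) : ℤ) = (m + 1) % Δ.deg v :=
      Int.toNat_of_nonneg (Int.emod_nonneg _ hd0.ne')
    have e1 : m + 1 = (((m + 1) % Δ.deg v).toNat : ℕ) + ((m + 1) / Δ.deg v) * Δ.deg v := by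
      rw [hcast]
      exact (Int.emod_add_ediv_mul _ _).symm
    have e2 : m = ((((m + 1) % Δ.deg v).toNat : ℕ) - 1) + ((m + 1) / Δ.deg v) * Δ.deg v := by
      linarith
    obtain ⟨h1, h2⟩ := hk ⟨_, hlt⟩
    have turn_add' : ∀ a b n : ℤ, Δ.turn β v (a + n * Δ.deg v) (b + n * Δ.deg v) =
        Δ.turn β v a b := by
      intro a b n
      rw [turn_add hβ, ← turn_inv hβ, turn_add hβ, turn_inv hβ]
    have c1 := corner_add v (((m + 1) % Δ.deg v).toNat : ℕ) ((m + 1) / Δ.deg v)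
    have c2 := corner_add v ((((m + 1) % Δ.deg v).toNat : ℕ) - 1) ((m + 1) / Δ.deg v)
    have t1 := turn_add' (((m + 1) % Δ.deg v).toNat : ℕ) ((((m + 1) % Δ.deg v).toNat : ℕ) - 1)
      ((m + 1) / Δ.deg v)
    have t2 := turn_add' ((((m + 1) % Δ.deg v).toNat : ℕ) - 1) (((m + 1) % Δ.deg v).toNat : ℕ)
      ((m + 1) / Δ.deg v)
    rw [← e1] at c1 t1 t2
    rw [← e2] at c2 t1 t2
    rw [c1, c2, t1, t2]
    exact ⟨h1, h2⟩
  have hle : ∀ n : ℕ, P (Δ.corner v m) (Δ.corner v (m + n)) (Δ.turn β v m (m + n)) := by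
    intro n
    induction n with
    | zero => simpa [turn_self hβ] using hone (Δ.corner v m)
    | succ n ih =>
      rw [← turn_mul hβ v m (m + n)]
      have := (hstep (m + n)).1
      rw [add_assoc] at this
      exact_mod_cast hmul _ _ _ _ _ ih this
  have hge : ∀ n : ℕ, P (Δ.corner v m) (Δ.corner v (m - n)) (Δ.turn β v m (m - n)) := by
    intro n
    induction n with
    | zero => simpa [turn_self hβ] using hone (Δ.corner v m)
    | succ n ih =>
      rw [← turn_mul hβ v m (m - n)]
      have := (hstep (m - (n + 1 : ℕ))).2
      rw [show m - ((n + 1 : ℕ) : ℤ) + 1 = m - n by push_cast; ring] at this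
      exact hmul _ _ _ _ _ ih this
  rcases le_total m m' with h | h
  · have := hle (m' - m).toNat
    rwa [Int.toNat_of_nonneg (by omega), add_sub_cancel] at this
  · have := hge (m - m').toNat
    rwa [Int.toNat_of_nonneg (by omega), sub_sub_cancel] at this

/-- The dual loops generate the fundamental groupoid on the tiles. -/
theorem fundamentalGroup_induction [T2Space S] (hβ : Δ.IsTileCompatible β)
    (hone : ∀ T, P T T 1)
    (hmul : ∀ T T' T'' g g', P T T' g → P T' T'' g' → P T T'' (g' * g))
    (hd : ∀ e, P (Δ.quiver.s e) (Δ.quiver.t e) (Δ.dualLoop β e))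
    (hd' : ∀ e, P (Δ.quiver.t e) (Δ.quiver.s e) (Δ.dualLoop β e)⁻¹) (T T' : Δ.Tile)
    (g : FundamentalGroup S x₀) : P T T' g := by
  have hcover : ∀ i {y y' : S} (p : Path y y'), (∀ t, p t ∈ Δ.coverSet i) →
      ∀ (hy : y ∉ Δ.support) (hy' : y' ∉ Δ.support),
      P (Δ.tile y hy) (Δ.tile y' hy') (loopOf β (.mk p)) := by
    intro i y y' p hp hy hy'
    cases i with
    | none =>
      rw [hβ.loopOf_eq_one p hp, tile_eq_of_path p hp hy hy']
      exact hone _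
    | some v =>
      obtain ⟨m, hm⟩ := exists_mem_sec (v := v) (by have := hp 0; rwa [p.source] at this) hy
      obtain ⟨m', hm'⟩ := exists_mem_sec (v := v) (by have := hp 1; rwa [p.target] at this) hy'
      rw [tile_eq_corner hm, tile_eq_corner hm', loopOf_eq_turn hβ hm hm' p hp]
      exact turn_mem_of_dualLoop_mem hβ hone hmul hd hd' v m m'
  -- `P` makes sense only for paths with ends outside of the graph, but the cutting points of a path
  -- may lie on it. So the property carried along is that `P` holds after continuation by any short
  -- path to a point outside.
  have hgood : ∀ {y y' : S} (γ : Path.Homotopic.Quotient y y'),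
      ∀ (z : S) (hz : z ∉ Δ.support) (ζ : Path.Homotopic.Quotient z y),
      (∀ i u (hu : u ∉ Δ.support) (δ : Path y u), (∀ t, δ t ∈ Δ.coverSet i) →
        P (Δ.tile z hz) (Δ.tile u hu) (loopOf β (ζ.trans (.mk δ)))) →
      (∀ i u (hu : u ∉ Δ.support) (δ : Path y' u), (∀ t, δ t ∈ Δ.coverSet i) →
        P (Δ.tile z hz) (Δ.tile u hu) (loopOf β ((ζ.trans γ).trans (.mk δ)))) := by
    intro y y' γ
    refine Path.Homotopic.Quotient.induction_of_open_cover (P := fun {y y'} γ =>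
      ∀ (z : S) (hz : z ∉ Δ.support) (ζ : Path.Homotopic.Quotient z y),
      (∀ i u (hu : u ∉ Δ.support) (δ : Path y u), (∀ t, δ t ∈ Δ.coverSet i) →
        P (Δ.tile z hz) (Δ.tile u hu) (loopOf β (ζ.trans (.mk δ)))) →
      (∀ i u (hu : u ∉ Δ.support) (δ : Path y' u), (∀ t, δ t ∈ Δ.coverSet i) →
        P (Δ.tile z hz) (Δ.tile u hu) (loopOf β ((ζ.trans γ).trans (.mk δ)))))
      isOpen_coverSet (exists_mem_coverSet Δ) ?_ ?_ γ
    · intro i y y' p hp z hz ζ h j u hu δ hδ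
      have hi : y' ∈ Δ.coverSet i := by simpa using hp 1
      have hj : y' ∈ Δ.coverSet j := by simpa using hδ 0
      -- A detour `q` and back, to a point outside of the graph which is still in both members of
      -- the cover, splits the path into two pieces with admissible ends.
      obtain ⟨u', q, hu', hq⟩ := exists_path_to_compl_support (Δ := Δ)
        (((isOpen_coverSet i).inter (isOpen_coverSet j)).mem_nhds ⟨hi, hj⟩)
      have h1 := h i u' hu' (p.trans q) (trans_mem hp fun t => (hq t).1)
      have h2 := hcover j (q.symm.trans δ) (trans_mem (fun t => (hq _).2) hδ) hu' hu
      have h3 := hmul _ _ _ _ _ h1 h2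
      rw [← loopOf_trans, Path.Homotopic.Quotient.mk_trans, Path.Homotopic.Quotient.mk_trans,
        Path.Homotopic.Quotient.mk_symm] at h3
      convert h3 using 2
      simp only [Path.Homotopic.Quotient.trans_assoc]
      rw [← Path.Homotopic.Quotient.trans_assoc (.mk q), Path.Homotopic.Quotient.trans_symm,
        Path.Homotopic.Quotient.refl_trans]
    · intro x y z γ γ' h1 h2 w hw ζ h
      have := h2 w hw (ζ.trans γ) (h1 w hw ζ h)
      simpa only [Path.Homotopic.Quotient.trans_assoc] using this
  obtain ⟨⟨y, hy⟩, rfl⟩ := ConnectedComponents.surjective_coe T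
  obtain ⟨⟨y', hy'⟩, rfl⟩ := ConnectedComponents.surjective_coe T'
  obtain ⟨γ, rfl⟩ := exists_loopOf_eq β y y' g
  have h := hgood γ y hy (.refl y) (fun i u hu δ hδ => by
    rw [Path.Homotopic.Quotient.refl_trans]
    exact hcover i δ hδ hy hu) none y' hy' (Path.refl y') (fun _ => hy')
  rwa [Path.Homotopic.Quotient.refl_trans, Path.Homotopic.Quotient.mk_refl,
    Path.Homotopic.Quotient.trans_refl] at h

end Generation

/-! ### Representations of the fundamental group from labels of the edges. -/

section Existence

/-- The index of the half-open sector at `v` that contains a given point. -/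
noncomputable def sectorIndex (v : Δ.V) (y : S) : ℤ :=
  match Δ.colour v with
  | Colour.black => ⌊ang (Δ.deg v) (Δ.chart v y)⌋
  | Colour.white => ⌈ang (Δ.deg v) (Δ.chart v y)⌉ - 1

theorem sectorIndex_of_mem_hsec {v : Δ.V} {m : ℤ} {y : S} (hy : y ∈ Δ.hsec v m) :
    ∃ n : ℤ, sectorIndex v y = m + n * Δ.deg v := by
  have key : ∀ {A : Set ℝ}, y ∈ Δ.sector v A →
      ∃ θ ∈ A, ∃ n : ℤ, ang (Δ.deg v) (Δ.chart v y) = θ + n * Δ.deg v := by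
    intro A h
    obtain ⟨-, ρ, hρ, θ, hθ, h⟩ := mem_sector.1 h
    refine ⟨θ, hθ, ?_⟩
    refine eq_add_int_mul_of_mul_dir_eq (Δ.degPos v) (ρ := ‖Δ.chart v y‖) ?_ hρ.1.le
      ((eq_norm_mul_dir_ang (Δ.degPos v) _).symm.trans h)
    rw [h, norm_mul_dir _ hρ.1.le]
    exact hρ.1
  cases hv : Δ.colour v with
  | black =>
    simp only [hsec, hv] at hy
    obtain ⟨θ, hθ, n, hn⟩ := key hy
    refine ⟨n, ?_⟩
    simp only [sectorIndex, hv]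
    rw [Int.floor_eq_iff, hn]
    push_cast
    constructor <;> linarith [hθ.1, hθ.2]
  | white =>
    simp only [hsec, hv] at hy
    obtain ⟨θ, hθ, n, hn⟩ := key hy
    refine ⟨n, ?_⟩
    simp only [sectorIndex, hv]
    rw [sub_eq_iff_eq_add, Int.ceil_eq_iff, hn]
    push_cast
    constructor <;> linarith [hθ.1, hθ.2]

variable {G : Type*} [Group G]

/-- Since their product around `v` is trivial, the labels integrate to a function on the sectors:
crossing an edge along its dual arrow multiplies it by the label. -/
theorem exists_vertex_potential (a : Δ.E → G)
    (ha : ∀ v, ((Δ.cycWord v).map a).prod = 1) (v : Δ.V) :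
    ∃ P : ℤ → G, (∀ m n : ℤ, P (m + n * Δ.deg v) = P m) ∧
      (Δ.colour v = Colour.black → ∀ k : Fin (Δ.deg v),
        P ((k : ℕ) - 1) = a (Δ.edgeAt v k).1 * P (k : ℕ)) ∧
      (Δ.colour v = Colour.white → ∀ k : Fin (Δ.deg v),
        P (k : ℕ) = a (Δ.edgeAt v k).1 * P ((k : ℕ) - 1)) := by
  obtain ⟨P, hP, hP'⟩ := exists_periodic_potential (Δ.degPos v) (ccwStep a v)
    ((prod_cycWord_eq_one_iff a v).1 (ha v))
  refine ⟨P, hP, fun hv k => ?_, fun hv k => ?_⟩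
  · rw [hP' k, ccwStep_black a hv, mul_inv_cancel_left]
  · rw [hP' k, ccwStep_white a hv]

/-- A point of the graph in the stars of two different vertices is an inner point of an edge
between them. -/
theorem exists_edge_of_mem_star_inter {v w : Δ.V} (hvw : v ≠ w) {y : S} (hv : y ∈ Δ.star v)
    (hw : y ∈ Δ.star w) (hs : y ∈ Δ.support) :
    ∃ (k : Fin (Δ.deg v)) (l : Fin (Δ.deg w)) (t : I), t ∈ Set.Ioo (0 : I) 1 ∧
      Δ.colour v ≠ Δ.colour w ∧
      (Δ.edgeAt v k).1 = (Δ.edgeAt w l).1 ∧ y = Δ.arc (Δ.edgeAt v k).1 t := by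
  have harc : ∀ {u : Δ.V} (k : Fin (Δ.deg u)), y ∈ Δ.sector u {((k : ℕ) : ℝ)} →
      ∃ t ∈ Set.Ioo (0 : I) 1, y = Δ.arc (Δ.edgeAt u k).1 t := by
    intro u k hk
    obtain ⟨t, ht, rfl⟩ := mem_sector_ray_iff.1 hk
    rcases colour_eq_or u with hu | hu
    · exact ⟨t, ht, EmbeddedGraph.arcFrom_black _ _ hu _⟩
    · refine ⟨σ t, ⟨?_, ?_⟩, EmbeddedGraph.arcFrom_white _ _ hu _⟩
      · rw [← unitInterval.symm_one]
        exact unitInterval.strictAnti_symm ht.2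
      · rw [← unitInterval.symm_zero]
        exact unitInterval.strictAnti_symm ht.1
  rcases eq_pt_or_of_mem_support hv hs with h1 | ⟨k, hk⟩
  · rcases eq_pt_or_of_mem_support hw hs with h2 | ⟨l, hl⟩
    · exact absurd (Δ.pt_injective (h1.symm.trans h2)) hvw
    · obtain ⟨t, ht, h⟩ := harc l hl
      exact absurd (h.symm.trans h1) (Δ.arc_ne_pt _ t ht v)
  · obtain ⟨t, ht, h⟩ := harc k hk
    rcases eq_pt_or_of_mem_support hw hs with h2 | ⟨l, hl⟩
    · exact absurd (h.symm.trans h2) (Δ.arc_ne_pt _ t ht w)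
    · obtain ⟨t', ht', h'⟩ := harc l hl
      have he := (Δ.arc_injective _ _ t ht t' ht' (h.symm.trans h')).1
      exact ⟨k, l, t, ht, fun hc => hvw ((Δ.edgeAt v k).2.symm.trans
        ((congrArg₂ Δ.endpt he hc).trans (Δ.edgeAt w l).2)), he, h⟩

/-- A family of group elements on the edges with trivial products around the vertices comes from
a representation of the fundamental group. -/
theorem exists_monoidHom_of_prod_eq_one [T2Space S] (hβ : Δ.IsTileCompatible β) (a : Δ.E → G)
    (ha : ∀ v, ((Δ.cycWord v).map a).prod = 1) :
    ∃ (φ : FundamentalGroup S x₀ →* G) (c : Δ.Tile → G), ∀ e,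
      a e = c (Δ.quiver.t e) * φ (Δ.dualLoop β e) * (c (Δ.quiver.s e))⁻¹ := by
  choose P hP hPb hPw using exists_vertex_potential a ha
  -- The cochain for `exists_transport`: constant off the graph, and given by the potential on the
  -- sectors of a star. It jumps across the edges.
  let h : Option Δ.V → S → G := fun i y =>
    match i with
    | none => 1
    | some v => P v (sectorIndex v y)
  have hsecval : ∀ {v : Δ.V} {m : ℤ} {y : S}, y ∈ Δ.hsec v m → h (some v) y = P v m := by
    intro v m y hy
    obtain ⟨n, hn⟩ := sectorIndex_of_mem_hsec hy
    simp only [h]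
    rw [hn, hP]
  have hconst : ∀ i y, y ∈ Δ.coverSet i → y ∉ Δ.support → ∀ᶠ z in 𝓝 y, h i z = h i y := by
    intro i y hy hs
    cases i with
    | none => exact Filter.Eventually.of_forall fun _ => rfl
    | some v =>
      obtain ⟨m, hm⟩ := exists_mem_sec hy hs
      filter_upwards [(isOpen_sec v m).mem_nhds hm] with z hz
      rw [hsecval (sec_subset_hsec v m hz), hsecval (sec_subset_hsec v m hm)]
  -- Across an edge the values at both ends are multiplied on the left by the same label, so their
  -- quotient does not jump.
  have hedge : ∀ {b w : Δ.V} {k : Fin (Δ.deg b)} {l : Fin (Δ.deg w)}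
      (hb : Δ.colour b = Colour.black) (hw : Δ.colour w = Colour.white)
      (he : (Δ.edgeAt b k).1 = (Δ.edgeAt w l).1) {t : I} (ht : t ∈ Set.Ioo (0 : I) 1),
      ∀ᶠ y in 𝓝 (Δ.arc (Δ.edgeAt b k).1 t), (h (some w) y)⁻¹ * h (some b) y =
        (P w ((l : ℕ) - 1))⁻¹ * P b (k : ℕ) := by
    intro b w k l hb hw he t ht
    filter_upwards [eventually_hsec hb hw he ht] with y hy
    rcases hy with ⟨h1, h2⟩ | ⟨h1, h2⟩
    · rw [hsecval h1, hsecval h2]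
    · rw [hsecval h1, hsecval h2, hPb b hb k, hPw w hw l, he]
      group
  have hloc : ∀ i j, ∀ x ∈ Δ.coverSet i ∩ Δ.coverSet j, ∀ᶠ y in 𝓝 x,
      (h j y)⁻¹ * h i y = (h j x)⁻¹ * h i x := by
    rintro i j x ⟨hi, hj⟩
    by_cases hs : x ∈ Δ.support
    swap
    · filter_upwards [hconst i x hi hs, hconst j x hj hs] with y h1 h2
      rw [h1, h2]
    cases i with
    | none => exact absurd hs hi
    | some v =>
      cases j with
      | none => exact absurd hs hj
      | some w =>
        rcases eq_or_ne v w with rfl | hvw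
        · simp
        obtain ⟨k, l, t, ht, hc, he, rfl⟩ := exists_edge_of_mem_star_inter hvw hi hj hs
        rcases colour_eq_or v with hv | hv <;> rcases colour_eq_or w with hw | hw
        · exact absurd (hv.trans hw.symm) hc
        · have := hedge hv hw he ht
          filter_upwards [this] with y hy
          rw [hy, this.self_of_nhds]
        · have := hedge hw hv he.symm ht
          rw [← he] at this
          filter_upwards [this] with y hy
          have h1 := this.self_of_nhds
          rw [← hy] at h1
          simpa using congrArg (·⁻¹) h1.symm
        · exact absurd (hv.trans hw.symm) hc
  obtain ⟨Ψ, hΨ, hΨU⟩ := exists_transport isOpen_coverSet (exists_mem_coverSet Δ) h hloc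
  have hΨrefl : ∀ x : S, Ψ (Path.Homotopic.Quotient.refl x) = 1 := by
    intro x
    have := hΨ (.refl x) (.refl x)
    rw [Path.Homotopic.Quotient.refl_trans] at this
    simpa using this
  have hΨsymm : ∀ {x y : S} (γ : Path.Homotopic.Quotient x y), Ψ γ.symm = (Ψ γ)⁻¹ := by
    intro x y γ
    have := hΨ γ γ.symm
    rw [Path.Homotopic.Quotient.trans_symm, hΨrefl] at this
    exact eq_inv_of_mul_eq_one_left this.symm
  let φ : FundamentalGroup S x₀ →* G :=
    { toFun := fun g => Ψ (FundamentalGroup.toPath g)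
      map_one' := hΨrefl x₀
      map_mul' := fun g g' => hΨ (FundamentalGroup.toPath g') (FundamentalGroup.toPath g) }
  have hφ : ∀ {y y' : S} (γ : Path.Homotopic.Quotient y y'),
      φ (loopOf β γ) = (Ψ (β y'))⁻¹ * Ψ γ * Ψ (β y) := by
    intro y y' γ
    change Ψ ((β y).trans (γ.trans (β y').symm)) = _
    rw [hΨ, hΨ, hΨsymm]
  let base : Δ.Tile → ↥(Δ.supportᶜ) := Function.surjInv ConnectedComponents.surjective_coe
  refine ⟨φ, fun T => Ψ (β (base T)), fun e => ?_⟩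
  -- Transport inside a tile is trivial, so the gauge depends only on the tile.
  have hbase : ∀ y (hy : y ∉ Δ.support), Ψ (β (base (Δ.tile y hy))) = Ψ (β y) := by
    intro y hy
    have hT : (ConnectedComponents.mk (base (Δ.tile y hy)) : Δ.Tile) = Δ.tile y hy :=
      Function.surjInv_eq ConnectedComponents.surjective_coe _
    have hpc : PathConnectedSpace (connectedComponent (base (Δ.tile y hy))) := by
      have := Δ.simplyConnected_tile (base (Δ.tile y hy))
      infer_instance
    let p := (PathConnectedSpace.somePath
      (⟨base (Δ.tile y hy), mem_connectedComponent⟩ : connectedComponent (base (Δ.tile y hy)))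
      ⟨⟨y, hy⟩, ConnectedComponents.coe_eq_coe'.1 hT.symm⟩).map
        (continuous_subtype_val.comp continuous_subtype_val)
    have hp : ∀ t, p t ∉ Δ.support := fun t => Subtype.property (p := fun z => z ∉ Δ.support) _
    have h1 := hΨU none p hp
    have h2 := congrArg Ψ (hβ p hp)
    rw [hΨ, h1] at h2
    simpa [h] using h2
  obtain ⟨y, y', p, hp, h1, h2, h3, h4⟩ := exists_crossing_edge e
  have hs : Δ.quiver.s e = Δ.tile y (sec_disjoint_support h1) := (tile_eq_corner h1).symm
  have ht : Δ.quiver.t e = Δ.tile y' (sec_disjoint_support h3) := (tile_eq_corner h3).symm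
  have hd : Δ.dualLoop β e = loopOf β (.mk p) := (loopOf_eq_turn hβ h1 h3 p fun t => (hp t).1).symm
  have hΨp : Ψ (.mk p) = a e := by
    rw [hΨU (some (Δ.endpt e Colour.black)) p fun t => (hp t).1,
      hsecval (sec_subset_hsec _ _ h1), hsecval (sec_subset_hsec _ _ h3),
      hPb _ (Δ.colour_endpt e _), edgeAt_posEnd]
    group
  rw [hs, ht]
  beta_reduce
  rw [hbase, hbase, hd, hφ, hΨp]
  group

end Existence

end BraneTiling

end Tiling

/-! ### Cyclic words and the derivatives of the potential. -/

namespace Tiling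

namespace FinQuiver

/-- The word `l` is a path from `i` to `j` (its last letter is traversed first). -/
def IsPathWord (Q : FinQuiver) : List Q.Arr → Q.Vert → Q.Vert → Prop
  | [], i, j => i = j
  | a :: l, i, j => Q.t a = j ∧ IsPathWord Q l i (Q.s a)

variable {Q : FinQuiver}

theorem isPathWord_append {l l' : List Q.Arr} {i j : Q.Vert} :
    Q.IsPathWord (l ++ l') i j ↔ ∃ k, Q.IsPathWord l' i k ∧ Q.IsPathWord l k j := by
  induction l generalizing j with
  | nil => simp [IsPathWord]
  | cons a l ih =>
    simp only [List.cons_append, IsPathWord, ih]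
    constructor
    · rintro ⟨h, k, h1, h2⟩
      exact ⟨k, h1, h, h2⟩
    · rintro ⟨k, h1, h, h2⟩
      exact ⟨h, k, h1, h2⟩

theorem isPathWord_ofFn {d : ℕ} (f : Fin d → Q.Arr) (c : ℤ → Q.Vert)
    (ht : ∀ k : Fin d, Q.t (f k) = c ((k : ℕ) - 1)) (hs : ∀ k : Fin d, Q.s (f k) = c (k : ℕ)) :
    Q.IsPathWord (List.ofFn f) (c (d - 1)) (c (-1)) := by
  induction d generalizing c with
  | zero => simp [IsPathWord]
  | succ d ih =>
    rw [List.ofFn_succ]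
    refine ⟨by simpa using ht 0, ?_⟩
    have h := ih (fun k => f k.succ) (fun m => c (m + 1)) (fun k => by simpa using ht k.succ)
      (fun k => by simpa using hs k.succ)
    have h0 := hs 0
    simp only [Fin.val_zero, Nat.cast_zero] at h0
    rw [h0]
    simpa using h

theorem isPathWord_reverse_ofFn {d : ℕ} (f : Fin d → Q.Arr) (c : ℤ → Q.Vert)
    (hs : ∀ k : Fin d, Q.s (f k) = c ((k : ℕ) - 1)) (ht : ∀ k : Fin d, Q.t (f k) = c (k : ℕ)) :
    Q.IsPathWord (List.ofFn f).reverse (c (-1)) (c (d - 1)) := by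
  induction d with
  | zero => simp [IsPathWord]
  | succ d ih =>
    rw [List.ofFn_succ', List.concat_eq_append, List.reverse_append]
    refine ⟨by simpa using ht (Fin.last d), ?_⟩
    have h := ih (fun k => f k.castSucc) (fun k => by simpa using hs k.castSucc)
      (fun k => by simpa using ht k.castSucc)
    have h0 := hs (Fin.last d)
    simp only [Fin.val_last] at h0
    rw [h0]
    exact h

theorem sum_lists_dropFirst_eq_zero (Q' : Set Q.Arr) {a : Q.Arr} {l : List Q.Arr} (ha : a ∉ l) :
    ((l : Cycle Q.Arr).lists.map (Q.dropFirst Q' a)).sum = 0 := by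
  refine Multiset.sum_eq_zero fun x hx => ?_
  obtain ⟨r, hr, rfl⟩ := Multiset.mem_map.1 hx
  have hr : r ∈ l.cyclicPermutations := hr
  cases r with
  | nil => rfl
  | cons b r =>
    have hb : b ∈ l := by
      rcases List.mem_cyclicPermutations_iff.1 hr with h
      exact h.mem_iff.1 (by simp)
    have : b ≠ a := fun h => ha (h ▸ hb)
    simp [dropFirst, this]

/-- As `a` occurs only once, the unrotated word is the only rotation that starts with `a`. -/
theorem sum_lists_dropFirst (Q' : Set Q.Arr) {a : Q.Arr} {r : List Q.Arr} (ha : a ∉ r) :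
    (((a :: r : List Q.Arr) : Cycle Q.Arr).lists.map (Q.dropFirst Q' a)).sum =
      Q.locTriv Q' (Q.s a) * (r.map (Q.locArr Q')).prod := by
  have h1 : (a :: r).cyclicPermutations =
      (List.range (r.length + 1)).map fun i => (a :: r).rotate i := by
    refine List.ext_getElem (by simp) fun i h1 h2 => ?_
    simp
  have h2 : ((a :: r : List Q.Arr) : Cycle Q.Arr).lists =
      (((a :: r).cyclicPermutations : List (List Q.Arr)) : Multiset (List Q.Arr)) := rfl
  rw [h2, h1, Multiset.map_coe, Multiset.sum_coe, List.map_map, List.range_succ_eq_map,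
    List.map_cons, List.sum_cons, List.sum_eq_zero, add_zero]
  · simp [dropFirst]
  · intro x hx
    simp only [List.map_map, List.mem_map, List.mem_range, Function.comp_apply] at hx
    obtain ⟨i, hi, rfl⟩ := hx
    have : (a :: r).rotate (i + 1) = r[i] :: (r.drop (i + 1) ++ a :: r.take i) := by
      rw [List.rotate_eq_drop_append_take (by simpa using hi.le)]
      simp only [List.drop_succ_cons, List.take_succ_cons]
      rw [List.drop_eq_getElem_cons hi, List.cons_append]
    rw [Nat.succ_eq_add_one, this]
    have hne : r[i] ≠ a := fun h => ha (h ▸ List.getElem_mem hi)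
    simp [dropFirst, hne]

end FinQuiver

namespace BraneTiling

variable {S : Type*} [TopologicalSpace S] {Δ : BraneTiling S}

theorem isPathWord_cycWord (v : Δ.V) :
    Δ.quiver.IsPathWord (Δ.cycWord v) (Δ.corner v (-1)) (Δ.corner v (-1)) := by
  have h : Δ.corner v (Δ.deg v - 1) = Δ.corner v (-1) := by
    have := corner_add v (-1) 1
    rw [← this]
    congr 1
    ring
  rcases colour_eq_or v with hv | hv
  · rw [cycWord_black hv]
    have := FinQuiver.isPathWord_ofFn (Q := Δ.quiver) (fun k => (Δ.edgeAt v k).1) (Δ.corner v)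
      (target_of_black hv) (source_of_black hv)
    rwa [h] at this
  · rw [cycWord_white hv]
    have := FinQuiver.isPathWord_reverse_ofFn (Q := Δ.quiver) (fun k => (Δ.edgeAt v k).1)
      (Δ.corner v) (source_of_white hv) (target_of_white hv)
    rwa [h] at this

theorem nodup_cycWord (v : Δ.V) : (Δ.cycWord v).Nodup := by
  have : (List.ofFn fun k => (Δ.edgeAt v k).1).Nodup :=
    List.nodup_ofFn.2 (Subtype.val_injective.comp (Δ.edgeAt v).injective)
  rcases colour_eq_or v with hv | hv
  · rwa [cycWord_black hv]
  · rwa [cycWord_white hv, List.nodup_reverse]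

theorem mem_cycWord {v : Δ.V} {e : Δ.E} : e ∈ Δ.cycWord v ↔ Δ.endpt e (Δ.colour v) = v := by
  have : e ∈ (List.ofFn fun k => (Δ.edgeAt v k).1) ↔ Δ.endpt e (Δ.colour v) = v := by
    rw [List.mem_ofFn]
    constructor
    · rintro ⟨k, rfl⟩
      exact (Δ.edgeAt v k).2
    · intro h
      exact ⟨(Δ.edgeAt v).symm ⟨e, h⟩, by simp⟩
  rcases colour_eq_or v with hv | hv
  · rwa [cycWord_black hv]
  · rwa [cycWord_white hv, List.mem_reverse]

theorem mem_cycWord_endpt (e : Δ.E) (c : Colour) : e ∈ Δ.cycWord (Δ.endpt e c) := by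
  rw [mem_cycWord, Δ.colour_endpt]

/-- The word `c_v` can be rotated such that it starts with a given edge at `v`. -/
theorem exists_isRotated_cycWord {v : Δ.V} {e : Δ.E} (he : e ∈ Δ.cycWord v) :
    ∃ r : List Δ.E, Δ.cycWord v ~r (e :: r) ∧ e ∉ r ∧
      Δ.quiver.IsPathWord r (Δ.quiver.t e) (Δ.quiver.s e) := by
  obtain ⟨u, w, h⟩ := List.append_of_mem he
  have hrot : Δ.cycWord v ~r (e :: (w ++ u)) := by
    rw [h]
    exact List.isRotated_append
  refine ⟨w ++ u, hrot, ?_, ?_⟩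
  · have := hrot.nodup_iff.1 (nodup_cycWord v)
    exact (List.nodup_cons.1 this).1
  · have hp := isPathWord_cycWord v
    rw [h] at hp
    obtain ⟨k, ⟨h1, h2⟩, h3⟩ := FinQuiver.isPathWord_append.1 hp
    exact FinQuiver.isPathWord_append.2 ⟨_, h1 ▸ h3, h2⟩

/-- The edge occurs only in the cycles at its two ends, once in each, with the sign `-1` at the
black and `+1` at the white end. -/
theorem deriv_potential (Q' : Set Δ.quiver.Arr) (e : Δ.E) {r r' : List Δ.E}
    (hr : Δ.cycWord (Δ.endpt e Colour.black) ~r (e :: r)) (her : e ∉ r)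
    (hr' : Δ.cycWord (Δ.endpt e Colour.white) ~r (e :: r')) (her' : e ∉ r') :
    Δ.quiver.deriv Q' Δ.potential e =
      (-1 : ℂ) • (Δ.quiver.locTriv Q' (Δ.quiver.s e) * (r.map (Δ.quiver.locArr Q')).prod) +
      Δ.quiver.locTriv Q' (Δ.quiver.s e) * (r'.map (Δ.quiver.locArr Q')).prod := by
  classical
  have hne : Δ.endpt e Colour.black ≠ Δ.endpt e Colour.white := by
    intro h
    have := congrArg Δ.colour h
    rw [Δ.colour_endpt, Δ.colour_endpt] at this
    exact Colour.noConfusion this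
  have hcyc : ∀ {v : Δ.V} {l : List Δ.E}, Δ.cycWord v ~r l → Δ.cyc v = (l : Cycle Δ.E) := by
    intro v l h
    rw [cyc_eq]
    exact Cycle.coe_eq_coe.2 h
  unfold FinQuiver.deriv potential
  rw [Multiset.map_map]
  change ∑ v : Δ.V, _ = _
  rw [Finset.sum_eq_add _ _ hne]
  · simp only [Function.comp_apply, Δ.colour_endpt]
    rw [hcyc hr, hcyc hr']
    erw [FinQuiver.sum_lists_dropFirst (Q := Δ.quiver) Q' her,
      FinQuiver.sum_lists_dropFirst (Q := Δ.quiver) Q' her']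
    rw [one_smul]
  · rintro v - ⟨hv1, hv2⟩
    have : e ∉ Δ.cycWord v := by
      rw [mem_cycWord]
      rcases colour_eq_or v with hv | hv <;> rw [hv]
      · exact fun h => hv1 h.symm
      · exact fun h => hv2 h.symm
    simp only [Function.comp_apply]
    rw [cyc_eq]
    erw [FinQuiver.sum_lists_dropFirst_eq_zero (Q := Δ.quiver) Q' this]
    rw [smul_zero]
  · simp
  · simp

/-- All coefficients are `1` or `-1`, so the degree condition applies to every `c_v`; it counts the
letters in `E`. -/
theorem cut_cycWord {E : Set Δ.E} (hE : Δ.quiver.IsCut Δ.potential E) (v : Δ.V) :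
    (∃ e ∈ E, e ∈ Δ.cycWord v) ∧
      ∀ e ∈ E, ∀ r, Δ.cycWord v ~r (e :: r) → ∀ a ∈ r, a ∉ E := by
  classical
  have h : ((Δ.cycWord v).map fun a => if a ∈ E then 1 else 0).sum = 1 := by
    have hmem : ((match Δ.colour v with
      | Colour.black => (-1 : ℂ)
      | Colour.white => 1), Δ.cyc v) ∈ Δ.potential :=
      Multiset.mem_map.2 ⟨v, Finset.mem_univ v, rfl⟩
    have := hE _ hmem (by rcases colour_eq_or v with hv | hv <;> simp [hv])
    simp only [cyc_eq] at this
    exact this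
  constructor
  · by_contra hcon
    push Not at hcon
    rw [List.sum_eq_zero] at h
    · exact zero_ne_one h
    · intro x hx
      obtain ⟨a, ha, rfl⟩ := List.mem_map.1 hx
      exact if_neg fun h => hcon a h ha
  · intro e he r hr a ha haE
    rw [(hr.perm.map _).sum_eq, List.map_cons, List.sum_cons, if_pos he] at h
    have h0 : (r.map fun a => if a ∈ E then 1 else 0).sum = 0 := by omega
    have h1 : (if a ∈ E then 1 else 0) ∈ r.map fun a => if a ∈ E then 1 else 0 :=
      List.mem_map.2 ⟨a, ha, rfl⟩
    have := List.single_le_sum (fun _ _ => Nat.zero_le _) _ h1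
    rw [if_pos haE] at this
    omega

end BraneTiling

end Tiling

/-! ### Relations and universal property of the Jacobi algebra. -/

namespace Tiling

namespace FinQuiver

section PathAlgebra

variable (Q : FinQuiver)

theorem triv_mul_triv_self (i : Q.Vert) : Q.triv i * Q.triv i = Q.triv i := by
  simp only [triv, ← map_mul]
  exact RingQuot.mkAlgHom_rel ℂ (PathRel.idem i)

theorem triv_mul_triv_of_ne {i j : Q.Vert} (h : i ≠ j) : Q.triv i * Q.triv j = 0 := by
  simp only [triv, ← map_mul]
  rw [RingQuot.mkAlgHom_rel ℂ (PathRel.orth i j h), map_zero]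

theorem sum_triv : ∑ i, Q.triv i = 1 := by
  simp only [triv, ← map_sum]
  rw [RingQuot.mkAlgHom_rel ℂ PathRel.one, map_one]

theorem arr_mul_triv (a : Q.Arr) : Q.arr a * Q.triv (Q.s a) = Q.arr a := by
  simp only [triv, arr, ← map_mul]
  exact RingQuot.mkAlgHom_rel ℂ (PathRel.source a)

theorem triv_mul_arr (a : Q.Arr) : Q.triv (Q.t a) * Q.arr a = Q.arr a := by
  simp only [triv, arr, ← map_mul]
  exact RingQuot.mkAlgHom_rel ℂ (PathRel.target a)

variable {Q}

theorem exists_pathAlgebra_lift {B : Type*} [Semiring B] [Algebra ℂ B] (f : Q.Vert → B)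
    (g : Q.Arr → B) (hidem : ∀ i, f i * f i = f i) (horth : ∀ i j, i ≠ j → f i * f j = 0)
    (hone : ∑ i, f i = 1) (hs : ∀ a, g a * f (Q.s a) = g a) (ht : ∀ a, f (Q.t a) * g a = g a) :
    ∃ Θ : Q.PathAlgebra →ₐ[ℂ] B, (∀ i, Θ (Q.triv i) = f i) ∧ ∀ a, Θ (Q.arr a) = g a := by
  have hrel : ∀ ⦃x y⦄, PathRel Q x y → FreeAlgebra.lift ℂ (Sum.elim f g) x =
      FreeAlgebra.lift ℂ (Sum.elim f g) y := by
    rintro x y h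
    cases h with
    | idem i => simp [hidem]
    | orth i j h => simp [horth i j h]
    | one => simp [hone]
    | source a => simp [hs]
    | target a => simp [ht]
  refine ⟨RingQuot.liftAlgHom ℂ ⟨FreeAlgebra.lift ℂ (Sum.elim f g), hrel⟩, fun i => ?_, fun a => ?_⟩
  · simp [triv]
  · simp [arr]

theorem pathAlgebra_hom_ext {B : Type*} [Semiring B] [Algebra ℂ B] {φ ψ : Q.PathAlgebra →ₐ[ℂ] B}
    (ht : ∀ i, φ (Q.triv i) = ψ (Q.triv i)) (ha : ∀ a, φ (Q.arr a) = ψ (Q.arr a)) : φ = ψ := by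
  refine RingQuot.ringQuot_ext' ℂ _ _ (FreeAlgebra.hom_ext ?_)
  funext x
  cases x with
  | inl i => exact ht i
  | inr a => exact ha a

end PathAlgebra

section Jac

variable (Q : FinQuiver) (Q' : Set Q.Arr) (W : Q.Potential) (E : Set Q.Arr)

/-- The quotient map from the localized path algebra to the Jacobi algebra. -/
noncomputable def jacMk : Q.Localized Q' →ₐ[ℂ] Q.Jac2d Q' W E :=
  RingQuot.mkAlgHom ℂ (Jac2dRel Q Q' W E)

/-- The class of `e_i` in the Jacobi algebra. -/
noncomputable def jacTriv (i : Q.Vert) : Q.Jac2d Q' W E := Q.jacMk Q' W E (Q.locTriv Q' i)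

/-- The class of the arrow `a` in the Jacobi algebra. -/
noncomputable def jacArr (a : Q.Arr) : Q.Jac2d Q' W E := Q.jacMk Q' W E (Q.locArr Q' a)

/-- The inverse `a*` of an arrow `a` in the localized path algebra. -/
noncomputable def locStar (a : Q') : Q.Localized Q' :=
  RingQuot.mkAlgHom ℂ (LocRel Q Q') ((Q.double Q').arr (Sum.inr a))

/-- The class of `a*` in the Jacobi algebra. -/
noncomputable def jacStar (a : Q') : Q.Jac2d Q' W E := Q.jacMk Q' W E (Q.locStar Q' a)

theorem jacTriv_mul_self (i : Q.Vert) :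
    Q.jacTriv Q' W E i * Q.jacTriv Q' W E i = Q.jacTriv Q' W E i := by
  simp only [jacTriv, locTriv, ← map_mul]
  exact congrArg _ (congrArg _ ((Q.double Q').triv_mul_triv_self i))

theorem jacTriv_mul_of_ne {i j : Q.Vert} (h : i ≠ j) :
    Q.jacTriv Q' W E i * Q.jacTriv Q' W E j = 0 := by
  simp only [jacTriv, locTriv, ← map_mul]
  rw [(Q.double Q').triv_mul_triv_of_ne h, map_zero, map_zero]

theorem sum_jacTriv : ∑ i, Q.jacTriv Q' W E i = 1 := by
  have h1 : ∑ i : Q.Vert, Q.locTriv Q' i = 1 :=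
    (map_sum (RingQuot.mkAlgHom ℂ (LocRel Q Q')) (Q.double Q').triv Finset.univ).symm.trans
      ((congrArg _ (Q.double Q').sum_triv).trans (map_one _))
  simp only [jacTriv, ← map_sum]
  rw [h1, map_one]

theorem jacArr_mul_jacTriv (a : Q.Arr) :
    Q.jacArr Q' W E a * Q.jacTriv Q' W E (Q.s a) = Q.jacArr Q' W E a := by
  simp only [jacTriv, locTriv, jacArr, locArr, ← map_mul]
  exact congrArg _ (congrArg _ ((Q.double Q').arr_mul_triv (Sum.inl a)))

theorem jacTriv_mul_jacArr (a : Q.Arr) :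
    Q.jacTriv Q' W E (Q.t a) * Q.jacArr Q' W E a = Q.jacArr Q' W E a := by
  simp only [jacTriv, locTriv, jacArr, locArr, ← map_mul]
  exact congrArg _ (congrArg _ ((Q.double Q').triv_mul_arr (Sum.inl a)))

theorem jacStar_mul_jacTriv (a : Q') :
    Q.jacStar Q' W E a * Q.jacTriv Q' W E (Q.t a) = Q.jacStar Q' W E a := by
  simp only [jacTriv, locTriv, jacStar, locStar, ← map_mul]
  exact congrArg _ (congrArg _ ((Q.double Q').arr_mul_triv (Sum.inr a)))

theorem jacTriv_mul_jacStar (a : Q') :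
    Q.jacTriv Q' W E (Q.s a) * Q.jacStar Q' W E a = Q.jacStar Q' W E a := by
  simp only [jacTriv, locTriv, jacStar, locStar, ← map_mul]
  exact congrArg _ (congrArg _ ((Q.double Q').triv_mul_arr (Sum.inr a)))

theorem jacStar_mul_jacArr (a : Q') :
    Q.jacStar Q' W E a * Q.jacArr Q' W E a = Q.jacTriv Q' W E (Q.s a) := by
  simp only [jacTriv, locTriv, jacArr, locArr, jacStar, locStar, ← map_mul]
  exact congrArg _ (RingQuot.mkAlgHom_rel ℂ (LocRel.left a))

theorem jacArr_mul_jacStar (a : Q') :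
    Q.jacArr Q' W E a * Q.jacStar Q' W E a = Q.jacTriv Q' W E (Q.t a) := by
  simp only [jacTriv, locTriv, jacArr, locArr, jacStar, locStar, ← map_mul]
  exact congrArg _ (RingQuot.mkAlgHom_rel ℂ (LocRel.right a))

theorem jacArr_eq_zero {a : Q.Arr} (ha : a ∈ E) : Q.jacArr Q' W E a = 0 := by
  unfold jacArr jacMk
  rw [RingQuot.mkAlgHom_rel ℂ (Jac2dRel.arrow a ha), map_zero]

/-- The scalar `-1` supplies the additive inverses, so no subtraction on `M` is required. -/
theorem eq_of_neg_one_smul_add_eq_zero {M : Type*} [AddCommMonoid M] [Module ℂ M] {x y : M}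
    (h : (-1 : ℂ) • x + y = 0) : x = y := by
  have h0 : x + (-1 : ℂ) • x = 0 := by
    nth_rewrite 1 [← one_smul ℂ x]
    rw [← add_smul]
    simp
  calc x = x + ((-1 : ℂ) • x + y) := by rw [h, add_zero]
    _ = y := by rw [← add_assoc, h0, zero_add]

/-- The only use of `∂W/∂a = 0` in the Jacobi algebra: the complements of `a` in the two cycles
through it agree. -/
theorem jacTriv_mul_prod_eq {a : Q.Arr} (ha : a ∈ E) {r r' : List Q.Arr}
    (h : Q.deriv Q' W a = (-1 : ℂ) • (Q.locTriv Q' (Q.s a) * (r.map (Q.locArr Q')).prod) +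
      Q.locTriv Q' (Q.s a) * (r'.map (Q.locArr Q')).prod) :
    Q.jacTriv Q' W E (Q.s a) * (r.map (Q.jacArr Q' W E)).prod =
      Q.jacTriv Q' W E (Q.s a) * (r'.map (Q.jacArr Q' W E)).prod := by
  have h1 : Q.jacMk Q' W E (Q.deriv Q' W a) = 0 := by
    unfold jacMk
    rw [RingQuot.mkAlgHom_rel ℂ (Jac2dRel.deriv a ha), map_zero]
  rw [h, map_add, map_smul, map_mul, map_mul, map_list_prod, map_list_prod, List.map_map,
    List.map_map] at h1
  exact eq_of_neg_one_smul_add_eq_zero h1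

variable {Q Q' W E}

/-- The universal properties of the three successive quotients, with the derivative relations in the
shape that a tiling provides: two words with equal images. -/
theorem exists_jac2d_lift {B : Type*} [Semiring B] [Algebra ℂ B] (f : Q.Vert → B)
    (g : Q.Arr → B) (g' : Q' → B)
    (hidem : ∀ i, f i * f i = f i) (horth : ∀ i j, i ≠ j → f i * f j = 0)
    (hone : ∑ i, f i = 1) (hs : ∀ a, g a * f (Q.s a) = g a) (ht : ∀ a, f (Q.t a) * g a = g a)
    (hs' : ∀ a : Q', g' a * f (Q.t a) = g' a) (ht' : ∀ a : Q', f (Q.s a) * g' a = g' a)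
    (hl : ∀ a : Q', g' a * g a = f (Q.s a)) (hr : ∀ a : Q', g a * g' a = f (Q.t a))
    (hE : ∀ a ∈ E, g a = 0)
    (hder : ∀ a ∈ E, ∃ r r' : List Q.Arr,
      Q.deriv Q' W a = (-1 : ℂ) • (Q.locTriv Q' (Q.s a) * (r.map (Q.locArr Q')).prod) +
        Q.locTriv Q' (Q.s a) * (r'.map (Q.locArr Q')).prod ∧
      f (Q.s a) * (r.map g).prod = f (Q.s a) * (r'.map g).prod) :
    ∃ Θ : Q.Jac2d Q' W E →ₐ[ℂ] B, (∀ i, Θ (Q.jacTriv Q' W E i) = f i) ∧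
      (∀ a, Θ (Q.jacArr Q' W E a) = g a) ∧ ∀ a, Θ (Q.jacStar Q' W E a) = g' a := by
  obtain ⟨Θ₁, h1, h2⟩ := exists_pathAlgebra_lift (Q := Q.double Q') f (Sum.elim g g') hidem horth
    hone (by rintro (a | a); exacts [hs a, hs' a]) (by rintro (a | a); exacts [ht a, ht' a])
  have hrel1 : ∀ ⦃x y⦄, LocRel Q Q' x y → Θ₁ x = Θ₁ y := by
    rintro x y h
    cases h with
    | left a =>
      exact (map_mul Θ₁ _ _).trans ((congrArg₂ _ (h2 (Sum.inr a)) (h2 (Sum.inl a.1))).trans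
        ((hl a).trans (h1 (Q.s a)).symm))
    | right a =>
      exact (map_mul Θ₁ _ _).trans ((congrArg₂ _ (h2 (Sum.inl a.1)) (h2 (Sum.inr a))).trans
        ((hr a).trans (h1 (Q.t a)).symm))
  let Θ₂ : Q.Localized Q' →ₐ[ℂ] B := RingQuot.liftAlgHom ℂ ⟨Θ₁, hrel1⟩
  have k1 : ∀ i, Θ₂ (Q.locTriv Q' i) = f i := fun i =>
    (RingQuot.liftAlgHom_mkAlgHom_apply ℂ Θ₁ hrel1 _).trans (h1 i)
  have k2 : ∀ a, Θ₂ (Q.locArr Q' a) = g a := fun a =>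
    (RingQuot.liftAlgHom_mkAlgHom_apply ℂ Θ₁ hrel1 _).trans (h2 (Sum.inl a))
  have k3 : ∀ a, Θ₂ (Q.locStar Q' a) = g' a := fun a =>
    (RingQuot.liftAlgHom_mkAlgHom_apply ℂ Θ₁ hrel1 _).trans (h2 (Sum.inr a))
  have hrel2 : ∀ ⦃x y⦄, Jac2dRel Q Q' W E x y → Θ₂ x = Θ₂ y := by
    rintro x y h
    cases h with
    | arrow a ha => rw [k2, hE a ha, map_zero]
    | deriv a ha =>
      obtain ⟨r, r', h, h'⟩ := hder a ha
      have hm : ∀ l : List Q.Arr, Θ₂ (l.map (Q.locArr Q')).prod = (l.map g).prod := by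
        intro l
        rw [map_list_prod, List.map_map]
        congr 2
        funext a
        exact k2 a
      rw [h, map_add, map_smul, map_mul, map_mul, k1, hm, hm, h', map_zero]
      nth_rewrite 2 [← one_smul ℂ (f (Q.s a) * (r'.map g).prod)]
      rw [← add_smul, neg_add_cancel, zero_smul]
  exact ⟨RingQuot.liftAlgHom ℂ ⟨Θ₂, hrel2⟩,
    fun i => (RingQuot.liftAlgHom_mkAlgHom_apply ℂ Θ₂ hrel2 _).trans (k1 i),
    fun a => (RingQuot.liftAlgHom_mkAlgHom_apply ℂ Θ₂ hrel2 _).trans (k2 a),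
    fun a => (RingQuot.liftAlgHom_mkAlgHom_apply ℂ Θ₂ hrel2 _).trans (k3 a)⟩

theorem jac2d_hom_ext {B : Type*} [Semiring B] [Algebra ℂ B] {φ ψ : Q.Jac2d Q' W E →ₐ[ℂ] B}
    (h1 : ∀ i, φ (Q.jacTriv Q' W E i) = ψ (Q.jacTriv Q' W E i))
    (h2 : ∀ a, φ (Q.jacArr Q' W E a) = ψ (Q.jacArr Q' W E a))
    (h3 : ∀ a, φ (Q.jacStar Q' W E a) = ψ (Q.jacStar Q' W E a)) : φ = ψ := by
  refine RingQuot.ringQuot_ext' ℂ _ _ (RingQuot.ringQuot_ext' ℂ _ _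
    (pathAlgebra_hom_ext (Q := Q.double Q') h1 ?_))
  rintro (a | a)
  exacts [h2 a, h3 a]

end Jac

end FinQuiver

end Tiling

/-! ### Invertible elements between idempotents, and representations in units. -/

namespace Tiling

/-- `u` and `u'` are inverse to each other, as morphisms between the idempotents `e i` and
`e j`. -/
structure IsInvPair {ι J : Type*} [Semiring J] (e : ι → J) (i j : ι) (u u' : J) : Prop where
  left_mul : e j * u = u
  mul_right : u * e i = u
  left_mul' : e i * u' = u'
  mul_right' : u' * e j = u'
  mul : u * u' = e j
  mul' : u' * u = e i

namespace IsInvPair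

variable {ι J : Type*} [Semiring J] {e : ι → J} {i j k : ι} {u u' w w' : J}

theorem refl (h : e i * e i = e i) : IsInvPair e i i (e i) (e i) := ⟨h, h, h, h, h, h⟩

theorem symm (h : IsInvPair e i j u u') : IsInvPair e j i u' u :=
  ⟨h.left_mul', h.mul_right', h.left_mul, h.mul_right, h.mul', h.mul⟩

theorem comp (h : IsInvPair e i j u u') (h' : IsInvPair e j k w w') :
    IsInvPair e i k (w * u) (u' * w') where
  left_mul := by rw [← mul_assoc, h'.left_mul]
  mul_right := by rw [mul_assoc, h.mul_right]
  left_mul' := by rw [← mul_assoc, h.left_mul']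
  mul_right' := by rw [mul_assoc, h'.mul_right']
  mul := by rw [mul_assoc, ← mul_assoc u, h.mul, h'.left_mul', h'.mul]
  mul' := by rw [mul_assoc, ← mul_assoc w', h'.mul', h.left_mul, h.mul']

theorem unique (h : IsInvPair e i j u u') (h' : IsInvPair e i j u w) : u' = w := by
  rw [← h.mul_right', ← h'.mul, ← mul_assoc, h.mul', h'.left_mul']

theorem map {J' F : Type*} [Semiring J'] [FunLike F J J'] [RingHomClass F J J'] (Θ : F) {f : ι → J'} (hf : ∀ i, Θ (e i) = f i)
    (h : IsInvPair e i j u u') : IsInvPair f i j (Θ u) (Θ u') where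
  left_mul := by rw [← hf, ← map_mul, h.left_mul]
  mul_right := by rw [← hf, ← map_mul, h.mul_right]
  left_mul' := by rw [← hf, ← map_mul, h.left_mul']
  mul_right' := by rw [← hf, ← map_mul, h.mul_right']
  mul := by rw [← hf, ← map_mul, h.mul]
  mul' := by rw [← hf, ← map_mul, h.mul']

end IsInvPair

/-- The units which commute with a given element. -/
def commutingUnits {J : Type*} [Semiring J] (p : J) : Subgroup Jˣ where
  carrier := {u | Commute (u : J) p}
  mul_mem' := fun {a b} ha hb => by
    change Commute ((a * b : Jˣ) : J) p
    rw [Units.val_mul]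
    exact Commute.mul_left ha hb
  one_mem' := Commute.one_left p
  inv_mem' := fun {a} ha => Commute.units_inv_left ha

namespace FinQuiver

variable {Q : FinQuiver} {J : Type*} [Semiring J] {e : Q.Vert → J}

/-- The factor `e j` makes the empty word stand for an idempotent instead of `1`. -/
theorem isInvPair_prod (hidem : ∀ i, e i * e i = e i) {A A' : Q.Arr → J} {l : List Q.Arr}
    (hA : ∀ a ∈ l, IsInvPair e (Q.s a) (Q.t a) (A a) (A' a)) {i j : Q.Vert}
    (hl : Q.IsPathWord l i j) : ∃ u', IsInvPair e i j (e j * (l.map A).prod) u' := by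
  induction l generalizing j with
  | nil =>
    obtain rfl : i = j := hl
    exact ⟨e i, by simpa using IsInvPair.refl (hidem i)⟩
  | cons a l ih =>
    obtain ⟨rfl, hl⟩ := hl
    obtain ⟨u', hu'⟩ := ih (fun b hb => hA b (List.mem_cons_of_mem a hb)) hl
    have h := hA a List.mem_cons_self
    have := hu'.comp h
    rw [← mul_assoc, h.mul_right] at this
    refine ⟨u' * A' a, ?_⟩
    rwa [List.map_cons, List.prod_cons, ← mul_assoc, h.left_mul]

/-- The elements `A a` are invertible only between idempotents, whereas `hexist` needs units. So
they are carried to a single vertex `o` and extended to units of `J`; the gauge that `hexist`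
produces is then absorbed in the elements `m` and `n`. -/
theorem exists_representation {π ι : Type*} [Group π] (d : Q.Arr → π) (word : ι → List Q.Arr)
    [Nonempty Q.Vert]
    (hgen : ∀ P : Q.Vert → Q.Vert → π → Prop, (∀ i, P i i 1) →
      (∀ i j k g g', P i j g → P j k g' → P i k (g' * g)) →
      (∀ a, P (Q.s a) (Q.t a) (d a)) → (∀ a, P (Q.t a) (Q.s a) (d a)⁻¹) → ∀ i j g, P i j g)
    (hexist : ∀ (a : Q.Arr → Jˣ) (H : Subgroup Jˣ), (∀ b, a b ∈ H) →
      (∀ v, ((word v).map a).prod = 1) → ∃ (φ : π →* Jˣ) (c : Q.Vert → Jˣ),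
        (∀ g, φ g ∈ H) ∧ (∀ i, c i ∈ H) ∧ ∀ b, a b = c (Q.t b) * φ (d b) * (c (Q.s b))⁻¹)
    (hidem : ∀ i, e i * e i = e i) (horth : ∀ i j, i ≠ j → e i * e j = 0) (hone : ∑ i, e i = 1)
    {A A' : Q.Arr → J} (hA : ∀ a, IsInvPair e (Q.s a) (Q.t a) (A a) (A' a))
    (hword : ∀ v, ∃ a r, word v ~r (a :: r) ∧ Q.IsPathWord r (Q.t a) (Q.s a) ∧
      A a * (e (Q.s a) * (r.map A).prod) = e (Q.t a)) :
    ∃ (o : Q.Vert) (m n : Q.Vert → J) (ψ : π →* J), (∀ i, IsInvPair e o i (m i) (n i)) ∧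
      (∀ g, Commute (ψ g) (e o)) ∧ ∀ a, A a = m (Q.t a) * ψ (d a) * n (Q.s a) := by
  classical
  obtain ⟨o⟩ := ‹Nonempty Q.Vert›
  -- Generation, applied to a property that ignores the group element, shows that every vertex is
  -- joined to `o` by an invertible element.
  have hmn : ∀ i, ∃ mn : J × J, IsInvPair e o i mn.1 mn.2 := by
    have := hgen (fun i j _ => ∃ u u', IsInvPair e i j u u')
      (fun i => ⟨_, _, IsInvPair.refl (hidem i)⟩)
      (fun i j k _ _ ⟨u, u', h⟩ ⟨w, w', h'⟩ => ⟨_, _, h.comp h'⟩)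
      (fun a => ⟨_, _, hA a⟩) (fun a => ⟨_, _, (hA a).symm⟩)
    intro i
    obtain ⟨u, u', h⟩ := this o i 1
    exact ⟨(u, u'), h⟩
  choose mn hmn using hmn
  -- `q` is the complement of `e o`, obtained without subtraction as the sum of the other
  -- idempotents.
  obtain ⟨q, hoq, hq1, hq2⟩ : ∃ q, e o + q = 1 ∧ e o * q = 0 ∧ q * e o = 0 := by
    refine ⟨∑ i ∈ Finset.univ.erase o, e i, ?_, ?_, ?_⟩
    · rw [Finset.add_sum_erase _ _ (Finset.mem_univ o), hone]
    · rw [Finset.mul_sum]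
      exact Finset.sum_eq_zero fun i hi => horth _ _ (Finset.ne_of_mem_erase hi).symm
    · rw [Finset.sum_mul]
      exact Finset.sum_eq_zero fun i hi => horth _ _ (Finset.ne_of_mem_erase hi)
  have hqq : q * q = q := by
    calc q * q = (e o + q) * q := by rw [add_mul, hq1, zero_add]
      _ = q := by rw [hoq, one_mul]
  have hmq : ∀ i, (mn i).1 * q = 0 := fun i => by
    rw [← (hmn i).mul_right, mul_assoc, hq1, mul_zero]
  have hqn : ∀ i, q * (mn i).2 = 0 := fun i => by
    rw [← (hmn i).left_mul', ← mul_assoc, hq2, zero_mul]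
  have hqm : ∀ {u u' : J}, IsInvPair e o o u u' → q * u = 0 ∧ u * q = 0 := fun {u u'} h => by
    constructor
    · rw [← h.left_mul, ← mul_assoc, hq2, zero_mul]
    · rw [← h.mul_right, mul_assoc, hq1, mul_zero]
  have hunit : ∀ {u u' : J}, IsInvPair e o o u u' → (u + q) * (u' + q) = 1 := by
    intro u u' h
    rw [add_mul, mul_add, mul_add, h.mul, (hqm h).2, (hqm h.symm).1, hqq, add_zero, zero_add, hoq]
  have hloop : ∀ a, IsInvPair e o o ((mn (Q.t a)).2 * (A a * (mn (Q.s a)).1))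
      ((mn (Q.s a)).2 * A' a * (mn (Q.t a)).1) := fun a =>
    ((hmn (Q.s a)).comp (hA a)).comp (hmn (Q.t a)).symm
  -- Carried to `o`, the element is invertible in `e o * J * e o`; adding `q` makes it a unit of
  -- `J`.
  let U : Q.Arr → Jˣ := fun a =>
    ⟨(mn (Q.t a)).2 * (A a * (mn (Q.s a)).1) + q, (mn (Q.s a)).2 * A' a * (mn (Q.t a)).1 + q,
      hunit (hloop a), hunit (hloop a).symm⟩
  -- Along a path word the inner factors `m` and `n` cancel.
  have hprod : ∀ (l : List Q.Arr) (i j : Q.Vert), Q.IsPathWord l i j →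
      (((l.map U).prod : Jˣ) : J) = (mn j).2 * (e j * (l.map A).prod * (mn i).1) + q := by
    intro l
    induction l with
    | nil =>
      rintro i j h
      obtain rfl : i = j := h
      simp [(hmn i).left_mul, (hmn i).mul', hoq]
    | cons a l ih =>
      rintro i j ⟨rfl, h⟩
      rw [List.map_cons, List.prod_cons, Units.val_mul, ih _ _ h, List.map_cons, List.prod_cons]
      change ((mn (Q.t a)).2 * (A a * (mn (Q.s a)).1) + q) * _ = _
      have h1 : (mn (Q.t a)).2 * (A a * (mn (Q.s a)).1) * q = 0 := (hqm (hloop a)).2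
      have h2 : q * ((mn (Q.s a)).2 * (e (Q.s a) * (l.map A).prod * (mn i).1)) = 0 := by
        rw [← mul_assoc, hqn, zero_mul]
      rw [add_mul, mul_add, mul_add, h1, h2, hqq, add_zero, zero_add]
      congr 1
      rw [mul_assoc (mn (Q.t a)).2, mul_assoc (A a), ← mul_assoc (mn (Q.s a)).1 (mn (Q.s a)).2,
        (hmn (Q.s a)).mul, ← mul_assoc (e (Q.t a)) (A a), (hA a).left_mul]
      congr 1
      simp only [← mul_assoc]
      rw [mul_assoc (A a) (e (Q.s a)) (e (Q.s a)), hidem, (hA a).mul_right]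
  have hcomm : ∀ a, U a ∈ commutingUnits (e o) := by
    intro a
    change ((mn (Q.t a)).2 * (A a * (mn (Q.s a)).1) + q) * e o =
      e o * ((mn (Q.t a)).2 * (A a * (mn (Q.s a)).1) + q)
    rw [add_mul, mul_add, hq1, hq2, (hloop a).mul_right, (hloop a).left_mul]
  have hU : ∀ v, ((word v).map U).prod = 1 := by
    intro v
    obtain ⟨a, r, hrot, hr, h⟩ := hword v
    have h1 : ((a :: r).map U).prod = 1 := by
      have hp : Q.IsPathWord (a :: r) (Q.t a) (Q.t a) := ⟨rfl, hr⟩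
      refine Units.ext ?_
      rw [hprod _ _ _ hp, List.map_cons, List.prod_cons, ← mul_assoc (e _), (hA a).left_mul]
      rw [← mul_assoc, (hA a).mul_right] at h
      rw [h, (hmn _).left_mul, (hmn _).mul', hoq, Units.val_one]
    obtain ⟨N', hN'⟩ := hrot.symm
    have h4 := List.prod_rotate_eq_one_of_prod_eq_one h1 N'
    rwa [← List.map_rotate, hN'] at h4
  -- Staying among the units that commute with `e o` ensures that `φ` and `c` preserve the corner `e
  -- o * J * e o`.
  obtain ⟨φ, c, hφ, hc, hφc⟩ := hexist U (commutingUnits (e o)) hcomm hU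
  have hcc : ∀ i, Commute (c i : J) (e o) := hc
  have hcc' : ∀ i, Commute ((c i)⁻¹ : Jˣ).val (e o) := fun i => Commute.units_inv_left (hc i)
  refine ⟨o, fun i => (mn i).1 * c i, fun i => ((c i)⁻¹ : Jˣ) * (mn i).2,
    (Units.coeHom J).comp φ, fun i => ?_, hφ, fun a => ?_⟩
  · have hci : IsInvPair e o o (c i * e o) (((c i)⁻¹ : Jˣ) * e o) :=
      { left_mul := by rw [(hcc i).eq, ← mul_assoc, hidem]
        mul_right := by rw [mul_assoc, hidem]
        left_mul' := by rw [(hcc' i).eq, ← mul_assoc, hidem]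
        mul_right' := by rw [mul_assoc, hidem]
        mul := by rw [(hcc i).eq, mul_assoc, Units.mul_inv_cancel_left, hidem]
        mul' := by rw [(hcc' i).eq, mul_assoc, Units.inv_mul_cancel_left, hidem] }
    have h := hci.comp (hmn i)
    have h1 : (mn i).1 * (c i * e o) = (mn i).1 * c i := by
      rw [(hcc i).eq, ← mul_assoc, (hmn i).mul_right]
    have h2 : (((c i)⁻¹ : Jˣ) * e o) * (mn i).2 = ((c i)⁻¹ : Jˣ) * (mn i).2 := by
      rw [mul_assoc, (hmn i).left_mul']
    rwa [h1, h2] at h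
  · have h := congrArg (fun u : Jˣ => (mn (Q.t a)).1 * (u : J) * (mn (Q.s a)).2) (hφc a)
    simp only [Units.val_mul] at h
    change (mn (Q.t a)).1 * ((mn (Q.t a)).2 * (A a * (mn (Q.s a)).1) + q) * (mn (Q.s a)).2 = _ at h
    rw [mul_add, hmq, add_zero, ← mul_assoc, (hmn (Q.t a)).mul, ← mul_assoc, (hA a).left_mul,
      mul_assoc, (hmn (Q.s a)).mul, (hA a).mul_right] at h
    rw [h]
    simp only [MonoidHom.coe_comp, Function.comp_apply, Units.coeHom_apply, mul_assoc]

/-- The homomorphism from a matrix algebra over a group algebra which is given by a system of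
matrix units and a representation of the group. -/
theorem exists_matrix_hom {π V : Type*} [Group π] [Fintype V] [DecidableEq V] [Algebra ℂ J]
    {e : V → J} (horth : ∀ i j, i ≠ j → e i * e j = 0) (hone : ∑ i, e i = 1) {o : V} {m n : V → J}
    (hmn : ∀ i, IsInvPair e o i (m i) (n i)) (ψ : π →* J) (hψ : ∀ g, Commute (ψ g) (e o)) :
    ∃ Λ : Matrix V V (MonoidAlgebra ℂ π) →ₐ[ℂ] J,
      ∀ i j g, Λ (Matrix.single i j (MonoidAlgebra.of ℂ π g)) = m i * ψ g * n j := by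
  let Φ : MonoidAlgebra ℂ π →ₐ[ℂ] J := MonoidAlgebra.lift ℂ J π ψ
  have hΦ : ∀ g, Φ (MonoidAlgebra.of ℂ π g) = ψ g := fun g => by simp [Φ]
  -- In a product of two values of `L` the middle factor `n k * m k = e o` appears; it is moved past
  -- `Φ` and absorbed by `m i`.
  have hcomm : ∀ x, Commute (Φ x) (e o) := by
    intro x
    induction x using MonoidAlgebra.induction_on with
    | of g => rw [hΦ]; exact hψ g
    | add x y hx hy => rw [map_add]; exact hx.add_left hy
    | smul r x hx => rw [map_smul]; exact hx.smul_left r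
  have hnm : ∀ i j, i ≠ j → n i * m j = 0 := by
    intro i j hij
    rw [← (hmn i).mul_right', ← (hmn j).left_mul, mul_assoc, ← mul_assoc (e i), horth i j hij,
      zero_mul, mul_zero]
  let L : Matrix V V (MonoidAlgebra ℂ π) →ₗ[ℂ] J :=
    { toFun := fun M => ∑ i, ∑ j, m i * Φ (M i j) * n j
      map_add' := fun M N => by
        simp only [Matrix.add_apply, map_add, mul_add, add_mul, Finset.sum_add_distrib]
      map_smul' := fun r M => by
        simp only [Matrix.smul_apply, map_smul, mul_smul_comm, smul_mul_assoc, Finset.smul_sum,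
          RingHom.id_apply] }
  have hL : ∀ M, L M = ∑ i, ∑ j, m i * Φ (M i j) * n j := fun M => rfl
  have hL1 : L 1 = 1 := by
    rw [hL, ← hone]
    refine Finset.sum_congr rfl fun i _ => ?_
    rw [Finset.sum_eq_single i]
    · rw [Matrix.one_apply_eq, map_one, mul_one, (hmn i).mul]
    · intro j _ hj
      rw [Matrix.one_apply_ne hj.symm, map_zero, mul_zero, zero_mul]
    · simp
  have hLmul : ∀ M N, L (M * N) = L M * L N := by
    intro M N
    rw [hL, hL, hL, Finset.sum_mul]
    refine Finset.sum_congr rfl fun i _ => ?_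
    rw [Finset.sum_mul]
    have h1 : ∀ k, m i * Φ (M i k) * n k * ∑ i', ∑ j, m i' * Φ (N i' j) * n j =
        ∑ j, m i * (Φ (M i k) * Φ (N k j)) * n j := by
      intro k
      rw [Finset.mul_sum, Finset.sum_eq_single k]
      · rw [Finset.mul_sum]
        refine Finset.sum_congr rfl fun j _ => ?_
        calc m i * Φ (M i k) * n k * (m k * Φ (N k j) * n j)
            = m i * (Φ (M i k) * (n k * m k)) * Φ (N k j) * n j := by simp only [mul_assoc]
          _ = m i * (Φ (M i k) * Φ (N k j)) * n j := by
            rw [(hmn k).mul', (hcomm _).eq, ← mul_assoc (m i), (hmn i).mul_right]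
            simp only [mul_assoc]
      · intro k' _ hk'
        rw [Finset.mul_sum]
        refine Finset.sum_eq_zero fun j _ => ?_
        calc m i * Φ (M i k) * n k * (m k' * Φ (N k' j) * n j)
            = m i * Φ (M i k) * (n k * m k') * Φ (N k' j) * n j := by simp only [mul_assoc]
          _ = 0 := by rw [hnm k k' hk'.symm]; simp
      · simp
    rw [Finset.sum_congr rfl fun k _ => h1 k, Finset.sum_comm]
    refine Finset.sum_congr rfl fun j _ => ?_
    rw [Matrix.mul_apply, map_sum, Finset.mul_sum, Finset.sum_mul]
    simp only [map_mul]
  refine ⟨AlgHom.ofLinearMap L hL1 hLmul, fun i j g => ?_⟩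
  rw [AlgHom.ofLinearMap_apply, hL, Finset.sum_eq_single i, Finset.sum_eq_single j]
  · rw [Matrix.single_apply_same, hΦ]
  · intro j' _ hj'
    rw [Matrix.single_apply_of_ne _ _ _ _ _ fun h => hj' h.2.symm, map_zero, mul_zero, zero_mul]
  · simp
  · intro i' _ hi'
    refine Finset.sum_eq_zero fun j' _ => ?_
    rw [Matrix.single_apply_of_ne _ _ _ _ _ fun h => hi' h.1.symm, map_zero, mul_zero, zero_mul]
  · simp

end FinQuiver

end Tiling

/-! ### Matrix units and the isomorphism. -/

namespace Tiling

namespace FinQuiver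

section MatrixUnits

variable {V π : Type*} [DecidableEq V] [Group π]

/-- The matrix with a group element as its only entry. -/
noncomputable def groupUnit (i j : V) (g : π) : Matrix V V (MonoidAlgebra ℂ π) :=
  Matrix.single i j (MonoidAlgebra.of ℂ π g)

variable [Fintype V]

theorem groupUnit_mul (i j k : V) (g h : π) :
    groupUnit i j g * groupUnit j k h = groupUnit i k (g * h) := by
  rw [groupUnit, groupUnit, groupUnit, Matrix.single_mul_single_same, map_mul]

theorem groupUnit_mul_of_ne {i j j' k : V} (hj : j ≠ j') (g h : π) :
    groupUnit i j g * groupUnit j' k h = 0 :=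
  Matrix.single_mul_single_of_ne _ _ _ _ hj _

theorem sum_groupUnit : ∑ i : V, groupUnit i i (1 : π) = 1 := by
  simp only [groupUnit, map_one]
  exact Matrix.sum_single_one

theorem isInvPair_groupUnit (i j : V) (g : π) :
    IsInvPair (fun i : V => groupUnit i i (1 : π)) i j (groupUnit j i g) (groupUnit i j g⁻¹) where
  left_mul := by simp [groupUnit_mul]
  mul_right := by simp [groupUnit_mul]
  left_mul' := by simp [groupUnit_mul]
  mul_right' := by simp [groupUnit_mul]
  mul := by simp [groupUnit_mul]
  mul' := by simp [groupUnit_mul]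

theorem matrix_hom_ext {B : Type*} [Semiring B] [Algebra ℂ B]
    {φ ψ : Matrix V V (MonoidAlgebra ℂ π) →ₐ[ℂ] B}
    (h : ∀ i j g, φ (groupUnit i j g) = ψ (groupUnit i j g)) : φ = ψ := by
  have h1 : ∀ i j x, φ (Matrix.single i j x) = ψ (Matrix.single i j x) := by
    intro i j x
    induction x using MonoidAlgebra.induction_on with
    | of g => exact h i j g
    | add x y hx hy => rw [Matrix.single_add, map_add, map_add, hx, hy]
    | smul r x hx => rw [← Matrix.smul_single, map_smul, map_smul, hx]
  refine AlgHom.ext fun M => ?_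
  rw [Matrix.matrix_eq_sum_single M]
  simp only [map_sum, h1]

end MatrixUnits

variable {Q : FinQuiver}

theorem groupUnit_mul_prod {π : Type*} [Group π] [DecidableEq Q.Vert] (d : Q.Arr → π)
    (g : Q.Arr → Matrix Q.Vert Q.Vert (MonoidAlgebra ℂ π)) {l : List Q.Arr}
    (hg : ∀ a ∈ l, g a = groupUnit (Q.t a) (Q.s a) (d a)) {i j : Q.Vert}
    (hl : Q.IsPathWord l i j) :
    groupUnit j j 1 * (l.map g).prod = groupUnit j i (l.map d).prod := by
  induction l generalizing j with
  | nil =>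
    obtain rfl : i = j := hl
    simp
  | cons a l ih =>
    obtain ⟨rfl, hl⟩ := hl
    have := ih (fun b hb => hg b (List.mem_cons_of_mem a hb)) hl
    rw [List.map_cons, List.prod_cons, List.map_cons, List.prod_cons, hg a List.mem_cons_self,
      ← groupUnit_mul _ (Q.s a), ← this, ← mul_assoc, groupUnit_mul, one_mul, ← mul_assoc,
      groupUnit_mul, mul_one]

/-- The algebraic core. The hypotheses `hgen` and `hexist` present the groupoid; `rb a` and `rw a`
are the complements of `a ∈ E` in the two cycles through it. -/
theorem nonempty_jac2d_algEquiv {E : Set Q.Arr} {W : Q.Potential} {π ι : Type*} [Group π]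
    [DecidableEq Q.Vert] [Nonempty Q.Vert] (d : Q.Arr → π) (word : ι → List Q.Arr)
    (hgen : ∀ P : Q.Vert → Q.Vert → π → Prop, (∀ i, P i i 1) →
      (∀ i j k g g', P i j g → P j k g' → P i k (g' * g)) →
      (∀ a, P (Q.s a) (Q.t a) (d a)) → (∀ a, P (Q.t a) (Q.s a) (d a)⁻¹) → ∀ i j g, P i j g)
    (hexist : ∀ (a : Q.Arr → (Q.Jac2d Eᶜ W E)ˣ) (H : Subgroup (Q.Jac2d Eᶜ W E)ˣ),
      (∀ b, a b ∈ H) → (∀ v, ((word v).map a).prod = 1) →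
      ∃ (φ : π →* (Q.Jac2d Eᶜ W E)ˣ) (c : Q.Vert → (Q.Jac2d Eᶜ W E)ˣ),
        (∀ g, φ g ∈ H) ∧ (∀ i, c i ∈ H) ∧ ∀ b, a b = c (Q.t b) * φ (d b) * (c (Q.s b))⁻¹)
    (rb rw : Q.Arr → List Q.Arr)
    (hrb : ∀ a ∈ E, Q.IsPathWord (rb a) (Q.t a) (Q.s a) ∧ (∀ b ∈ rb a, b ∉ E) ∧
      d a * ((rb a).map d).prod = 1)
    (hrw : ∀ a ∈ E, Q.IsPathWord (rw a) (Q.t a) (Q.s a) ∧ (∀ b ∈ rw a, b ∉ E) ∧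
      d a * ((rw a).map d).prod = 1)
    (hder : ∀ a ∈ E, Q.deriv Eᶜ W a =
      (-1 : ℂ) • (Q.locTriv Eᶜ (Q.s a) * ((rb a).map (Q.locArr Eᶜ)).prod) +
        Q.locTriv Eᶜ (Q.s a) * ((rw a).map (Q.locArr Eᶜ)).prod)
    (hword : ∀ v, ∃ a ∈ E, word v ~r (a :: rb a) ∨ word v ~r (a :: rw a)) :
    Nonempty (Q.Jac2d Eᶜ W E ≃ₐ[ℂ] Matrix Q.Vert Q.Vert (MonoidAlgebra ℂ π)) := by
  classical
  have hidem := Q.jacTriv_mul_self Eᶜ W E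
  have horth : ∀ i j, i ≠ j → Q.jacTriv Eᶜ W E i * Q.jacTriv Eᶜ W E j = 0 :=
    fun i j h => Q.jacTriv_mul_of_ne Eᶜ W E h
  have hone := Q.sum_jacTriv Eᶜ W E
  have hinv : ∀ a : ↥(Eᶜ : Set Q.Arr), IsInvPair (Q.jacTriv Eᶜ W E) (Q.s a) (Q.t a)
      (Q.jacArr Eᶜ W E a) (Q.jacStar Eᶜ W E a) := fun a =>
    ⟨Q.jacTriv_mul_jacArr Eᶜ W E a, Q.jacArr_mul_jacTriv Eᶜ W E a,
      Q.jacTriv_mul_jacStar Eᶜ W E a, Q.jacStar_mul_jacTriv Eᶜ W E a,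
      Q.jacArr_mul_jacStar Eᶜ W E a, Q.jacStar_mul_jacArr Eᶜ W E a⟩
  -- For `a ∈ E`, the arrow is zero in the Jacobi algebra, and its role is taken by the inverse of
  -- the complement `rb a`.
  have hpair : ∀ a, ∃ p : Q.Jac2d Eᶜ W E × Q.Jac2d Eᶜ W E,
      IsInvPair (Q.jacTriv Eᶜ W E) (Q.s a) (Q.t a) p.1 p.2 ∧ (a ∉ E → p.1 = Q.jacArr Eᶜ W E a) ∧
      (a ∈ E → p.2 = Q.jacTriv Eᶜ W E (Q.s a) * ((rb a).map (Q.jacArr Eᶜ W E)).prod) := by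
    intro a
    by_cases ha : a ∈ E
    · obtain ⟨hp, hE, -⟩ := hrb a ha
      obtain ⟨u', hu'⟩ := isInvPair_prod hidem (A := Q.jacArr Eᶜ W E)
        (A' := fun b => if h : b ∈ (Eᶜ : Set Q.Arr) then Q.jacStar Eᶜ W E ⟨b, h⟩ else 0)
        (l := rb a) (fun b hb => by
          have h : b ∈ (Eᶜ : Set Q.Arr) := hE b hb
          rw [dif_pos h]
          exact hinv ⟨b, h⟩) hp
      exact ⟨(u', _), hu'.symm, fun h => absurd ha h, fun _ => rfl⟩
    · exact ⟨(_, _), hinv ⟨a, ha⟩, fun _ => rfl, fun h => absurd h ha⟩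
  choose A hA hA1 hA2 using hpair
  have hA3 : ∀ l : List Q.Arr, (∀ b ∈ l, b ∉ E) →
      l.map (fun a => (A a).1) = l.map (Q.jacArr Eᶜ W E) := fun l hl =>
    List.map_congr_left fun b hb => hA1 b (hl b hb)
  have hword' : ∀ v, ∃ a r, word v ~r (a :: r) ∧ Q.IsPathWord r (Q.t a) (Q.s a) ∧
      (A a).1 * (Q.jacTriv Eᶜ W E (Q.s a) * (r.map fun a => (A a).1).prod) =
        Q.jacTriv Eᶜ W E (Q.t a) := by
    intro v
    obtain ⟨a, ha, h | h⟩ := hword v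
    · refine ⟨a, rb a, h, (hrb a ha).1, ?_⟩
      rw [hA3 _ (hrb a ha).2.1, ← hA2 a ha, (hA a).mul]
    · refine ⟨a, rw a, h, (hrw a ha).1, ?_⟩
      rw [hA3 _ (hrw a ha).2.1, ← Q.jacTriv_mul_prod_eq Eᶜ W E ha (hder a ha), ← hA2 a ha,
        (hA a).mul]
  obtain ⟨o, m, n, ψ, hmn, hψ, hAd⟩ :=
    exists_representation d word hgen hexist hidem horth hone hA hword'
  obtain ⟨Λ, hΛ⟩ := exists_matrix_hom horth hone hmn ψ hψ
  have hΛtriv : ∀ i, Λ (groupUnit i i 1) = Q.jacTriv Eᶜ W E i := fun i => by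
    rw [groupUnit, hΛ, map_one, mul_one, (hmn i).mul]
  have hΛA : ∀ a, Λ (groupUnit (Q.t a) (Q.s a) (d a)) = (A a).1 := fun a =>
    (hΛ _ _ _).trans (hAd a).symm
  -- Arrows of the cut have to be sent to zero, the others to the matrix units of their dual loops.
  let g : Q.Arr → Matrix Q.Vert Q.Vert (MonoidAlgebra ℂ π) := fun a =>
    if a ∈ E then 0 else groupUnit (Q.t a) (Q.s a) (d a)
  have hgE : ∀ a ∈ E, g a = 0 := fun a ha => if_pos ha
  have hg : ∀ a, a ∉ E → g a = groupUnit (Q.t a) (Q.s a) (d a) := fun a ha => if_neg ha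
  have hgprod : ∀ (a : Q.Arr) (l : List Q.Arr), Q.IsPathWord l (Q.t a) (Q.s a) →
      (∀ b ∈ l, b ∉ E) → d a * (l.map d).prod = 1 →
      groupUnit (Q.s a) (Q.s a) 1 * (l.map g).prod = groupUnit (Q.s a) (Q.t a) (d a)⁻¹ := by
    intro a l hl hlE hd
    rw [groupUnit_mul_prod d g (fun b hb => hg b (hlE b hb)) hl, inv_eq_of_mul_eq_one_right hd]
  obtain ⟨Θ, hΘtriv, hΘarr, hΘstar⟩ := exists_jac2d_lift (Q := Q) (Q' := Eᶜ) (W := W) (E := E)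
    (fun i => groupUnit i i (1 : π)) g (fun a => groupUnit (Q.s a) (Q.t a) (d a)⁻¹)
    (fun i => by rw [groupUnit_mul, one_mul]) (fun i j h => groupUnit_mul_of_ne h _ _)
    sum_groupUnit
    (fun a => by by_cases ha : a ∈ E <;> simp [hgE, hg, ha, groupUnit_mul])
    (fun a => by by_cases ha : a ∈ E <;> simp [hgE, hg, ha, groupUnit_mul])
    (fun a => by rw [groupUnit_mul, mul_one]) (fun a => by rw [groupUnit_mul, one_mul])
    (fun a => by rw [hg _ a.2, groupUnit_mul, inv_mul_cancel])
    (fun a => by rw [hg _ a.2, groupUnit_mul, mul_inv_cancel]) hgE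
    (fun a ha => ⟨rb a, rw a, hder a ha, by
      rw [hgprod a _ (hrb a ha).1 (hrb a ha).2.1 (hrb a ha).2.2,
        hgprod a _ (hrw a ha).1 (hrw a ha).2.1 (hrw a ha).2.2]⟩)
  -- For `a ∈ E` the image of the complement is known from the relation at a vertex; uniqueness of
  -- inverses then gives the image of `A a`.
  have hΘA : ∀ a, Θ (A a).1 = groupUnit (Q.t a) (Q.s a) (d a) := by
    intro a
    by_cases ha : a ∈ E
    · have h1 : Θ (A a).2 = groupUnit (Q.s a) (Q.t a) (d a)⁻¹ := by
        rw [hA2 a ha, map_mul, hΘtriv, map_list_prod, List.map_map,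
          ← hgprod a _ (hrb a ha).1 (hrb a ha).2.1 (hrb a ha).2.2]
        congr 3
        funext b
        exact hΘarr b
      have h2 := ((hA a).map Θ hΘtriv).symm
      rw [h1] at h2
      exact h2.unique (isInvPair_groupUnit _ _ _).symm
    · rw [hA1 a ha, hΘarr, hg a ha]
  refine ⟨AlgEquiv.ofAlgHom Θ Λ (matrix_hom_ext fun i j x => ?_) (jac2d_hom_ext ?_ ?_ ?_)⟩
  -- By generation it suffices to treat the matrix units of the dual loops and of their inverses.
  · refine hgen (fun i j x => Θ (Λ (groupUnit j i x)) = groupUnit j i x) (fun i => ?_)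
      (fun i j k x y hx hy => ?_) (fun a => ?_) (fun a => ?_) j i x
    · rw [hΛtriv, hΘtriv]
    · rw [← groupUnit_mul k j i, map_mul, map_mul, hx, hy]
    · rw [hΛA, hΘA]
    · have h := ((isInvPair_groupUnit (Q.s a) (Q.t a) (d a)).map Λ hΛtriv).map
        Θ hΘtriv
      rw [hΛA, hΘA] at h
      exact h.unique (isInvPair_groupUnit _ _ _)
  · intro i
    rw [AlgHom.comp_apply, hΘtriv, hΛtriv, AlgHom.id_apply]
  · intro a
    rw [AlgHom.comp_apply, hΘarr, AlgHom.id_apply]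
    by_cases ha : a ∈ E
    · rw [hgE a ha, map_zero, Q.jacArr_eq_zero Eᶜ W E ha]
    · rw [hg a ha, hΛA, hA1 a ha]
  · intro a
    rw [AlgHom.comp_apply, hΘstar, AlgHom.id_apply]
    have h := (isInvPair_groupUnit (Q.s a) (Q.t a) (d a)).map Λ hΛtriv
    rw [hΛA, hA1 _ a.2] at h
    exact h.unique (hinv a)

end FinQuiver

end Tiling

/-! ### The Jacobi algebra of a brane tiling. -/

namespace Tiling

namespace BraneTiling

variable {S : Type*} [TopologicalSpace S] {Δ : BraneTiling S}

theorem exists_isRotated_avoiding {E : Set Δ.E} (hE : Δ.quiver.IsCut Δ.potential E) {x : S}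
    {β : ∀ y : S, Path.Homotopic.Quotient x y} (hβ : Δ.IsTileCompatible β) (c : Colour) (a : Δ.E)
    (ha : a ∈ E) :
    ∃ r, Δ.cycWord (Δ.endpt a c) ~r (a :: r) ∧ a ∉ r ∧
      Δ.quiver.IsPathWord r (Δ.quiver.t a) (Δ.quiver.s a) ∧ (∀ b ∈ r, b ∉ E) ∧
      Δ.dualLoop β a * (r.map (Δ.dualLoop β)).prod = 1 := by
  obtain ⟨r, hr, har, hp⟩ := exists_isRotated_cycWord (Δ.mem_cycWord_endpt a c)
  refine ⟨r, hr, har, hp, (cut_cycWord hE _).2 a ha r hr, ?_⟩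
  obtain ⟨N, hN⟩ := hr
  have h := List.prod_rotate_eq_one_of_prod_eq_one (prod_dualLoop_cycWord hβ (Δ.endpt a c)) N
  rwa [← List.map_rotate, hN, List.map_cons, List.prod_cons] at h

theorem nonempty_jac2d_algEquiv [T2Space S] [PathConnectedSpace S] [DecidableEq Δ.quiver.Vert]
    {E : Set Δ.quiver.Arr} (hE : Δ.quiver.IsCut Δ.potential E) (x : S) :
    Nonempty (Δ.quiver.Jac2d Eᶜ Δ.potential E ≃ₐ[ℂ]
      Matrix Δ.quiver.Vert Δ.quiver.Vert (MonoidAlgebra ℂ (FundamentalGroup S x))) := by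
  classical
  obtain ⟨β, hβ⟩ := Δ.exists_isTileCompatible x
  obtain ⟨y, -, hy, -⟩ := exists_path_to_compl_support (Δ := Δ) (Filter.univ_mem (f := nhds x))
  have : Nonempty Δ.quiver.Vert := ⟨(ConnectedComponents.mk ⟨y, hy⟩ : Δ.Tile)⟩
  have hr : ∀ (c : Colour) (a : Δ.E), ∃ r, a ∈ E →
      Δ.cycWord (Δ.endpt a c) ~r (a :: r) ∧ a ∉ r ∧
      Δ.quiver.IsPathWord r (Δ.quiver.t a) (Δ.quiver.s a) ∧ (∀ b ∈ r, b ∉ E) ∧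
      Δ.dualLoop β a * (r.map (Δ.dualLoop β)).prod = 1 := by
    intro c a
    by_cases ha : a ∈ E
    · obtain ⟨r, hr⟩ := exists_isRotated_avoiding hE hβ c a ha
      exact ⟨r, fun _ => hr⟩
    · exact ⟨[], fun h => absurd h ha⟩
  choose r hr using hr
  refine FinQuiver.nonempty_jac2d_algEquiv (Q := Δ.quiver) (Δ.dualLoop β) Δ.cycWord
    (fun P h1 h2 h3 h4 => fundamentalGroup_induction hβ h1 h2 h3 h4) (fun a H ha h => ?_)
    (r Colour.black) (r Colour.white) (fun a ha => (hr _ a ha).2.2) (fun a ha => (hr _ a ha).2.2)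
    (fun a ha => deriv_potential Eᶜ a (hr _ a ha).1 (hr _ a ha).2.1 (hr _ a ha).1 (hr _ a ha).2.1)
    (fun v => ?_)
  -- Taking the subgroup `H` itself as the group of labels puts the values of `φ` and `c` in `H`.
  · obtain ⟨φ, c, hφ⟩ := exists_monoidHom_of_prod_eq_one hβ (fun b => (⟨a b, ha b⟩ : H))
      (fun v => Subtype.ext (by
        rw [← H.coe_subtype, map_list_prod, List.map_map]
        exact h v))
    exact ⟨H.subtype.comp φ, fun T => c T, fun g => (φ g).2, fun T => (c T).2,
      fun b => congrArg Subtype.val (hφ b)⟩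
  · obtain ⟨⟨a, ha, hav⟩, -⟩ := cut_cycWord hE v
    have h := Δ.mem_cycWord.1 hav
    refine ⟨a, ha, ?_⟩
    rcases Δ.colour_eq_or v with hv | hv
    · left
      rw [hv] at h
      exact h ▸ (hr Colour.black a ha).1
    · right
      rw [hv] at h
      exact h ▸ (hr Colour.white a ha).1

end BraneTiling

end Tiling

theorem mainTheorem3 {S : Type*} [TopologicalSpace S] [T2Space S] [CompactSpace S]
    [ConnectedSpace S] [ChartedSpace ℂ S]
    (Δ : Tiling.BraneTiling S) (E : Set Δ.quiver.Arr) (hE : Δ.quiver.IsCut Δ.potential E)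
    (r : ℕ) (hr : Nat.card Δ.quiver.Vert = r) (x : S) :
    Nonempty (Δ.quiver.Jac2d Eᶜ Δ.potential E ≃ₐ[ℂ]
      Matrix (Fin r) (Fin r) (MonoidAlgebra ℂ (FundamentalGroup S x))) := by
  classical
  -- The charts make `S` locally path connected, so every point can be joined to the base point.
  have := ChartedSpace.locallyPathConnectedSpace ℂ S
  have : PathConnectedSpace S := pathConnectedSpace_iff_connectedSpace.2 ‹_›
  obtain ⟨Θ⟩ := Tiling.BraneTiling.nonempty_jac2d_algEquiv hE x
  exact ⟨Θ.trans (Matrix.reindexAlgEquiv ℂ _ (Finite.equivFinOfCardEq hr))⟩
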